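/- **Notation.** Let $\Omega^k=\Omega^k(3)$ be the formal differential $k$-forms in $x_1,x_2,x_3$ with coefficients in $\Omega^0=\mathbb C[[x_1,x_2,x_3]]$, let $W_3=\{\sum_i P_i\partial_i : P_i\in\Omega^0\}$, $\mathrm{vol}=dx_1\wedge dx_2\wedge dx_3$, and identify $\Omega^3$ with $\Omega^0$ by $f\,\mathrm{vol}\leftrightarrow f$ and $\Omega^2$ with $W_3$ by $\iota_D\mathrm{vol}\leftrightarrow D$. Let $\varepsilon^+,\varepsilon^-$ be the standard basis of $\mathbb C^2$, with $\varepsilon^+\wedge\varepsilon^-=1$, and let $v\cdot v'\in S^2\mathbb C^2\simeq sl_2(\mathbb C)$ be the endomorphism $x\mapsto\frac12\big((v'\wedge x)v+(v\wedge x)v'\big)$. **The Lie superalgebra.** $L=E(3,8)$ is the Lie superalgebra with $$L_{\bar 0}=W_3+ sl_2(\Omega^0)+ d\Omega^1,\qquad L_{\bar 1}=\Omega^0\otimes\mathbb C^2+\Omega^2\otimes\mathbb C^2$$ and the following brackets, where $X,Y\in W_3$; $A,B\in sl_2(\Omega^0)$; $\omega,\omega'\in d\Omega^1$; $g,h\in\Omega^0$;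 $\sigma,\tau\in\Omega^2$; $v,w\in\mathbb C^2$; and $L_X$ is the Lie derivative: * $[X,Y]=[X,Y]_{W_3}-\frac12\, d(\operatorname{div}X)\wedge d(\operatorname{div}Y)$, $\ [X,A]=X(A)$, $\ [X,\omega]=L_X\omega$, $\ [A,B]=(AB-BA)+\operatorname{tr}(dA\wedge dB)$, $\ [A,\omega]=[\omega,\omega']=0$; * $[X,g\otimes v]=\big(X(g)-\frac12(\operatorname{div}X)g\big)\otimes v+\frac12\, d(\operatorname{div}X)\wedge dg\otimes v$, $\ [X,\sigma\otimes v]=\big(L_X\sigma-\frac12(\operatorname{div}X)\sigma\big)\otimes v$; * $[A,g\otimes v]=gAv+(dA\wedge dg)v$, $\ [A,\sigma\otimes v]=\sigma Av$, $\ [\omega,g\otimes v]=g\omega\otimes v$, $\ [\omega,\sigma\otimes v]=0$; * $[g\otimes v,h\otimes w]=-(v\wedge w)\,dg\wedge dh\in W_3$, $\ [\sigma\otimes v,\tau\otimes w]=(v\wedge w)\,d(\iota_\tau\iota_\sigma\mathrm{vol})\in d\Omega^1$; * $[g\otimes v,\tau\otimes w]=-(v\wedge w)\,g\tau-(dg\wedge\tau-g\,d\tau)\otimes(v\cdot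 w)-(v\wedge w)\,dg\wedge d(d\tau)$, where the three terms lie in $W_3$, $sl_2(\Omega^0)$ and $d\Omega^1$, and in the last term $d\tau\in\Omega^3$ is regarded as a function. Put $\deg x_i=-\deg\partial_i=\deg dx_i=2$, $\deg\varepsilon^\pm=-3$, $\deg sl_2(\mathbb C)=0$. Let $\mathfrak g_j$ be the component of degree $j$, and let $L_0$, $L_+$ be the parts of degree $\ge0$, $>0$ respectively. Thus $L_0$ consists of the sums of those $X+A+\omega$ and $\sum_a g_a\otimes\varepsilon^a+\sum_a\sigma_a\otimes\varepsilon^a$ for which $X(0)=0$, $g_a(0)=0$ and $dg_a(0)=0$. One has $\mathfrak g_0=sl_3(\mathbb C)\oplus sl_2(\mathbb C)\oplus\mathbb CY$, where $sl_3(\mathbb C)$ is the space of traceless linear vector fields and $Y=\frac23\sum_i x_i\partial_i\in W_3$. **The modules.** Let $W$ be the symplectic space with basis $x_i,z_a,\partial_i,\partial_a$ ($i=1,2,3$; $a=+,-$), where $(\partial_i,x_j)=-(x_j,\partial_i)=\delta_{ij}$, $(\partial_a,z_b)=-(z_b,\partial_a)=\delta_{ab}$ and all other pairings are zero. Let $H=T(W)/(vw-wv-(v,w)1)$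 be its Heisenberg algebra. Put $$L_A=L'_D=\langle x_i,z_a\rangle,\quad L_B=L'_C=\langle x_i,\partial_a\rangle,\quad L_C=L'_B=\langle\partial_i,z_a\rangle,\quad L_D=L'_A=\langle\partial_i,\partial_a\rangle,$$ and for $X\in\{A,B,C,D\}$ let $V_X=H/(L'_X)$ be the quotient of $H$ by the left ideal generated by $L'_X$. On the left $H$-module $V_X$ the Lie algebra $\mathfrak g_0$ acts as follows: $sl_3(\mathbb C)$ acts through $x_i\partial_j\mapsto x_i\partial_j\in H$, $sl_2(\mathbb C)$ through $E_{ab}\mapsto z_a\partial_b\in H$, and $Y$ through $Y^\sharp=-\frac43\sum_i x_i\partial_i+\sum_a z_a\partial_a\in H$. Extend this to $L_0$ by letting $L_+$ act by zero, and let $M(V_X)=U(L)\otimes_{U(L_0)}V_X$. **The element $\nabla$.** Put $d_i^\pm=x_i\otimes\varepsilon^\pm\in\mathfrak g_{-1}$. In the algebra $U(L)\otimes_{\mathbb C}\operatorname{End}(V_X)$ put $$\Delta^\pm=\sum_{i=1}^3 d_i^\pm\otimes\partial_i,\qquad \delta_\pm=1\otimes\partial_\pm,\qquad \nabla=\Delta^+\delta_++\Delta^-\delta_-=\sum_{i=1}^3\sum_{a=\pm}d_i^a\otimes\partial_i\partial_a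 .$$ **Proposition.** Let $X\in\{A,B,C,D\}$. (a) The element $\nabla$ defines a morphism of $E(3,8)$-modules $M(V_X)\to M(V_X)$: there is a unique $U(L)$-linear map $\varphi:M(V_X)\to M(V_X)$ such that $$\varphi(u\otimes f)=\sum_{i=1}^3\sum_{a=\pm}(u\,d_i^a)\otimes\partial_i\partial_a f\qquad\text{for all }u\in U(L),\ f\in V_X .$$ (b) $\nabla^2=0$: the map $\varphi$ satisfies $\varphi\circ\varphi=0$, and the square of $\nabla$ in the algebra $U(L)\otimes_{\mathbb C}\operatorname{End}(V_X)$ is zero. -/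

import Mathlib

open scoped TensorProduct

set_option linter.unusedSimpArgs false

noncomputable section

/-! ## Lie superalgebras, enveloping algebras and induced modules -/

/-- A Lie superalgebra over `ℂ` with even part `L₀` and odd part `L₁`, given by its three bracket
components `[even, even]`, `[even, odd]`, `[odd, odd]` (with `[odd, even] = -[even, odd]`),
subject to super-antisymmetry and the super Jacobi identity. -/
structure LieSuperalgebra (L₀ L₁ : Type*) [AddCommGroup L₀] [Module ℂ L₀]
    [AddCommGroup L₁] [Module ℂ L₁] where
  ee : L₀ →ₗ[ℂ] L₀ →ₗ[ℂ] L₀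
  eo : L₀ →ₗ[ℂ] L₁ →ₗ[ℂ] L₁
  oo : L₁ →ₗ[ℂ] L₁ →ₗ[ℂ] L₀
  ee_self : ∀ x, ee x x = 0
  oo_comm : ∀ a b, oo a b = oo b a
  jacobi_eee : ∀ x y z, ee x (ee y z) = ee (ee x y) z + ee y (ee x z)
  jacobi_eeo : ∀ x y a, eo x (eo y a) = eo (ee x y) a + eo y (eo x a)
  jacobi_eoo : ∀ x a b, ee x (oo a b) = oo (eo x a) b + oo a (eo x b)
  jacobi_ooo : ∀ a b c, eo (oo a b) c + eo (oo b c) a + eo (oo c a) b = 0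

namespace LieSuperalgebra

variable {L₀ L₁ : Type*} [AddCommGroup L₀] [Module ℂ L₀] [AddCommGroup L₁] [Module ℂ L₁]

/-- The defining relations `x y - (-1)^(p(x) p(y)) y x = [x, y]` of the universal enveloping
algebra. -/
inductive EnvRel (L : LieSuperalgebra L₀ L₁) :
    TensorAlgebra ℂ (L₀ × L₁) → TensorAlgebra ℂ (L₀ × L₁) → Prop
  | ee (x y : L₀) : EnvRel L
      (TensorAlgebra.ι ℂ (x, 0) * TensorAlgebra.ι ℂ (y, 0)
        - TensorAlgebra.ι ℂ (y, 0) * TensorAlgebra.ι ℂ (x, 0))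
      (TensorAlgebra.ι ℂ (L.ee x y, 0))
  | eo (x : L₀) (a : L₁) : EnvRel L
      (TensorAlgebra.ι ℂ (x, 0) * TensorAlgebra.ι ℂ (0, a)
        - TensorAlgebra.ι ℂ (0, a) * TensorAlgebra.ι ℂ (x, 0))
      (TensorAlgebra.ι ℂ (0, L.eo x a))
  | oo (a b : L₁) : EnvRel L
      (TensorAlgebra.ι ℂ (0, a) * TensorAlgebra.ι ℂ (0, b)
        + TensorAlgebra.ι ℂ (0, b) * TensorAlgebra.ι ℂ (0, a))
      (TensorAlgebra.ι ℂ (L.oo a b, 0))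

/-- The universal enveloping algebra `U(L)`. -/
def U (L : LieSuperalgebra L₀ L₁) : Type _ := RingQuot (EnvRel L)

instance (L : LieSuperalgebra L₀ L₁) : Ring L.U := inferInstanceAs (Ring (RingQuot (EnvRel L)))

instance (L : LieSuperalgebra L₀ L₁) : Algebra ℂ L.U :=
  inferInstanceAs (Algebra ℂ (RingQuot (EnvRel L)))

/-- The canonical map `L → U(L)`. -/
def ι (L : LieSuperalgebra L₀ L₁) : L₀ × L₁ →ₗ[ℂ] L.U :=
  (RingQuot.mkAlgHom ℂ (EnvRel L)).toLinearMap ∘ₗ TensorAlgebra.ι ℂ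

/-- A (graded) Lie subsuperalgebra. -/
structure Sub (L : LieSuperalgebra L₀ L₁) where
  even : Submodule ℂ L₀
  odd : Submodule ℂ L₁
  ee_mem : ∀ x ∈ even, ∀ y ∈ even, L.ee x y ∈ even
  eo_mem : ∀ x ∈ even, ∀ a ∈ odd, L.eo x a ∈ odd
  oo_mem : ∀ a ∈ odd, ∀ b ∈ odd, L.oo a b ∈ even

/-- A module over a Lie subsuperalgebra `P` on a purely even space `V`: the odd part of `P`
necessarily acts by zero, and the even part acts by `ρ`, compatibly with the brackets. -/
structure Sub.EvenModule {L : LieSuperalgebra L₀ L₁} (P : L.Sub)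
    (V : Type*) [AddCommGroup V] [Module ℂ V] where
  ρ : P.even →ₗ[ℂ] Module.End ℂ V
  ρ_ee : ∀ x y : P.even, ρ ⟨L.ee x y, P.ee_mem x x.2 y y.2⟩ = ρ x * ρ y - ρ y * ρ x
  ρ_oo : ∀ a b : P.odd, ρ ⟨L.oo a b, P.oo_mem a a.2 b b.2⟩ = 0

variable {L : LieSuperalgebra L₀ L₁} {P : L.Sub} {V : Type*} [AddCommGroup V] [Module ℂ V]

/-- The `U(L)`-submodule of `U(L) ⊗_ℂ V` generated by all `p ⊗ v - 1 ⊗ p v` with `p ∈ P`; it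
contains all `u p ⊗ v - u ⊗ p v`. -/
def inducedRel (M : P.EvenModule V) : Submodule L.U (L.U ⊗[ℂ] V) :=
  Submodule.span L.U
    ({t | ∃ (x : P.even) (v : V), t = L.ι ((x : L₀), 0) ⊗ₜ[ℂ] v - 1 ⊗ₜ[ℂ] (M.ρ x v)} ∪
     {t | ∃ (a : P.odd) (v : V), t = L.ι (0, (a : L₁)) ⊗ₜ[ℂ] v})

/-- The induced `L`-module `U(L) ⊗_{U(P)} V`. -/
abbrev Induced (M : P.EvenModule V) : Type _ := (L.U ⊗[ℂ] V) ⧸ inducedRel M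

/-- The class of `t ∈ U(L) ⊗_ℂ V` in `U(L) ⊗_{U(P)} V`. -/
def Induced.mk (M : P.EvenModule V) : (L.U ⊗[ℂ] V) →ₗ[L.U] Induced M := (inducedRel M).mkQ

/-- For `Φ = ∑ₘ uₘ ⊗ ℓₘ`, `u ∈ U(L)` and `v ∈ V`: the element `∑ₘ (u uₘ) ⊗ ℓₘ(v)`. -/
def insertInto (Φ : L.U ⊗[ℂ] Module.End ℂ V) (u : L.U) (v : V) : L.U ⊗[ℂ] V :=
  TensorProduct.map (LinearMap.mulLeft ℂ u) (LinearMap.applyₗ v) Φ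

end LieSuperalgebra

/-! ## The Lie superalgebra `E(3,8)` -/

namespace E38

/-- Formal functions `Ω⁰(3) = ℂ[[x₁, x₂, x₃]]` (the variables are indexed by `0, 1, 2`). -/
abbrev Fn := MvPowerSeries (Fin 3) ℂ

/-- Triples of functions. Such a triple `(P₁, P₂, P₃)` stands for a vector field `∑ Pᵢ ∂ᵢ`, or a
`1`-form `∑ Pᵢ dxᵢ`, or the `2`-form `P₁ dx₂∧dx₃ + P₂ dx₃∧dx₁ + P₃ dx₁∧dx₂`. The identification
`W₃ ≃ Ω²(3)⁻¹`, `D ↦ ι_D(dx₁∧dx₂∧dx₃)`, is then the identity on triples, and `3`-forms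
`f dx₁∧dx₂∧dx₃` are identified with functions `f`. -/
abbrev Tri := Fin 3 → Fn

/-- The partial derivative `∂ᵢ`. -/
abbrev pd (i : Fin 3) (f : Fn) : Fn := MvPowerSeries.pderiv ℂ i f

theorem pd_comm (i j : Fin 3) (f : Fn) : pd i (pd j f) = pd j (pd i f) := by
  ext n
  simp only [pd, MvPowerSeries.coeff_pderiv]
  by_cases h : i = j
  · subst h; rfl
  · have h1 : (Finsupp.single i 1 : Fin 3 →₀ ℕ) j = 0 := by simp [h]
    have h2 : (Finsupp.single j 1 : Fin 3 →₀ ℕ) i = 0 := by simp [Ne.symm h]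
    rw [add_right_comm]
    simp only [Finsupp.add_apply, h1, h2]
    push_cast; ring

theorem pd_mul (i : Fin 3) (f g : Fn) : pd i (f * g) = f * pd i g + pd i f * g := by
  simp only [pd, Derivation.leibniz, smul_eq_mul]; ring

theorem pd10 (f : Fn) : pd 1 (pd 0 f) = pd 0 (pd 1 f) := pd_comm _ _ _
theorem pd20 (f : Fn) : pd 2 (pd 0 f) = pd 0 (pd 2 f) := pd_comm _ _ _
theorem pd21 (f : Fn) : pd 2 (pd 1 f) = pd 1 (pd 2 f) := pd_comm _ _ _
theorem pd_add (i : Fin 3) (f g : Fn) : pd i (f + g) = pd i f + pd i g := map_add _ _ _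
theorem pd_sub (i : Fin 3) (f g : Fn) : pd i (f - g) = pd i f - pd i g := map_sub _ _ _
theorem pd_neg (i : Fin 3) (f : Fn) : pd i (-f) = - pd i f := map_neg _ _
theorem pd_C (i : Fin 3) (c : ℂ) : pd i (MvPowerSeries.C c) = 0 := MvPowerSeries.pderiv_C
theorem pd_zero (i : Fin 3) : pd i 0 = 0 := map_zero _
theorem pd_smul (i : Fin 3) (c : ℂ) (f : Fn) : pd i (c • f) = c • pd i f :=
  Derivation.map_smul _ _ _

/-- The differential `df` of a function. -/
def d0 (f : Fn) : Tri := ![pd 0 f, pd 1 f, pd 2 f]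

/-- The differential of a `1`-form. -/
def d1 (α : Tri) : Tri :=
  ![pd 1 (α 2) - pd 2 (α 1), pd 2 (α 0) - pd 0 (α 2), pd 0 (α 1) - pd 1 (α 0)]

/-- The divergence of a vector field, which is also the differential of a `2`-form. -/
def dv (X : Tri) : Fn := pd 0 (X 0) + pd 1 (X 1) + pd 2 (X 2)

/-- The wedge product of two `1`-forms. -/
def w11 (α β : Tri) : Tri :=
  ![α 1 * β 2 - α 2 * β 1, α 2 * β 0 - α 0 * β 2, α 0 * β 1 - α 1 * β 0]

/-- The wedge product of a `1`-form and a `2`-form. -/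
def w12 (α σ : Tri) : Fn := α 0 * σ 0 + α 1 * σ 1 + α 2 * σ 2

/-- The `1`-form `ι_Y ι_X (dx₁∧dx₂∧dx₃)`, where `X`, `Y` are the vector fields corresponding to
the `2`-forms `σ`, `τ`. -/
def con (σ τ : Tri) : Tri := w11 σ τ

/-- The derivative of a function along a vector field. -/
def ap (X : Tri) (f : Fn) : Fn := X 0 * pd 0 f + X 1 * pd 1 f + X 2 * pd 2 f

/-- The bracket of vector fields. -/
def vbr (X Y : Tri) : Tri := fun i => ap X (Y i) - ap Y (X i)

/-- The Lie derivative of a `2`-form; in terms of triples `L_X σ = [X, σ] + (div X) σ`. -/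
def lie2 (X σ : Tri) : Tri := fun i => vbr X σ i + dv X * σ i

/-- The constant function `1/2`. -/
def hf : Fn := MvPowerSeries.C (1 / 2 : ℂ)

theorem hf_two : hf * 2 = 1 := by
  have : (2 : Fn) = MvPowerSeries.C (2 : ℂ) := (map_ofNat _ 2).symm
  rw [hf, this, ← map_mul]; norm_num

theorem pd_hf (i : Fin 3) : pd i hf = 0 := pd_C _ _

/-- `v ∧ v'` for the basis vectors `ε⁺ = ε 0`, `ε⁻ = ε 1` of `ℂ²`, where `ε⁺ ∧ ε⁻ = 1`. -/
def ww : Matrix (Fin 2) (Fin 2) Fn := !![0, 1; -1, 0]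

/-- `v · v' ∈ S²ℂ² ≃ sl₂(ℂ)` for the basis vectors of `ℂ²`; it is the endomorphism
`x ↦ ((v' ∧ x) v + (v ∧ x) v') / 2`. -/
def sy (a b : Fin 2) : Matrix (Fin 2) (Fin 2) Fn :=
  Matrix.of fun c x => hf * ((if c = a then ww b x else 0) + (if c = b then ww a x else 0))

/-- The ambient space of the even part: triples `(X, A, ω)`. -/
abbrev EvAmb := Tri × Matrix (Fin 2) (Fin 2) Fn × Tri

/-- The even part `W₃ + sl₂(Ω⁰(3)) + dΩ¹(3)` of `E(3,8)`: here `X ∈ W₃`, `A` is traceless, and the `2`-form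
`ω` is closed. -/
def evSub : Submodule ℂ EvAmb where
  carrier := {x | x.2.1 0 0 + x.2.1 1 1 = 0 ∧ dv x.2.2 = 0}
  add_mem' := by
    rintro ⟨X, A, ω⟩ ⟨Y, B, η⟩ ⟨h1, h2⟩ ⟨h3, h4⟩
    constructor
    · simp only [Prod.mk_add_mk, Matrix.add_apply] at *
      linear_combination h1 + h3
    · simp only [Prod.mk_add_mk, dv, Pi.add_apply, map_add] at *
      linear_combination h2 + h4
  zero_mem' := by simp [dv]
  smul_mem' := by
    rintro c ⟨X, A, ω⟩ ⟨h1, h2⟩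
    constructor
    · simp only [Prod.smul_mk, Matrix.smul_apply] at *
      rw [← smul_add, h1, smul_zero]
    · simp only [Prod.smul_mk, dv, Pi.smul_apply, pd_smul] at *
      rw [← smul_add, ← smul_add, h2, smul_zero]

/-- The even part of `E(3,8)`. -/
abbrev Ev : Type := evSub

/-- The odd part `Ω⁰(3)^(-1/2) ⊗ ℂ² + Ω²(3)^(-1/2) ⊗ ℂ²` of `E(3,8)`: the pair `(g, σ)` stands
for `∑ₐ gₐ ⊗ εᵃ + ∑ₐ σₐ ⊗ εᵃ`. -/
abbrev Od : Type := (Fin 2 → Fn) × (Fin 2 → Tri)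

/-- The bracket of two even elements `(X, A, ω)`, `(Y, B, η)`:
`[X, Y] + ([A, B] + X B - Y A) + (L_X η - L_Y ω - ½ d(div X) ∧ d(div Y) + tr (dA ∧ dB))`. -/
def eeFun (x y : EvAmb) : EvAmb :=
  (vbr x.1 y.1,
   Matrix.of fun i j => (x.2.1 * y.2.1 - y.2.1 * x.2.1) i j
     + ap x.1 (y.2.1 i j) - ap y.1 (x.2.1 i j),
   lie2 x.1 y.2.2 - lie2 y.1 x.2.2 - hf • w11 (d0 (dv x.1)) (d0 (dv y.1))
     + ∑ i, ∑ j, w11 (d0 (x.2.1 i j)) (d0 (y.2.1 j i)))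

/-- The bracket of an even element `(X, A, ω)` and an odd element `(g, σ)`: the twisted Lie
derivative and matrix multiplication, together with the terms
`½ d(div X) ∧ dg`, `dA ∧ dg` and `g ω` with values in `Ω²(3) ⊗ ℂ²`. -/
def eoFun (x : EvAmb) (a : Od) : Od :=
  (fun i => ap x.1 (a.1 i) - hf * dv x.1 * a.1 i + ∑ j, x.2.1 i j * a.1 j,
   fun i => lie2 x.1 (a.2 i) - (hf * dv x.1) • a.2 i + ∑ j, x.2.1 i j • a.2 j
     + hf • w11 (d0 (dv x.1)) (d0 (a.1 i)) + ∑ j, w11 (d0 (x.2.1 i j)) (d0 (a.1 j))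
     + a.1 i • x.2.2)

/-- The bracket of two odd elements, the bilinear extension of
`[g ⊗ v, h ⊗ w] = -(dg ∧ dh) ⊗ (v ∧ w)`,
`[g ⊗ v, τ ⊗ w] = -(g τ) ⊗ (v ∧ w) - (dg ∧ τ - g dτ) ⊗ (v · w) - (dg ∧ d(dτ)) ⊗ (v ∧ w)`,
`[σ ⊗ v, τ ⊗ w] = d(ι_τ ι_σ vol) ⊗ (v ∧ w)`.
Here `dg ∧ dh`, `g τ` are seen as vector fields, `dg ∧ τ - g dτ` as a function, while
`dg ∧ d(dτ)` (`dτ` being seen as a function) and `d(ι_τ ι_σ vol)` are closed `2`-forms. -/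
def ooFun (a b : Od) : EvAmb :=
  (∑ i, ∑ j, ww i j • (- w11 (d0 (a.1 i)) (d0 (b.1 j)) - a.1 i • b.2 j + b.1 j • a.2 i),
   Matrix.of fun p q => ∑ i, ∑ j, sy i j p q *
     (-(w12 (d0 (a.1 i)) (b.2 j) - a.1 i * dv (b.2 j))
      - (w12 (d0 (b.1 j)) (a.2 i) - b.1 j * dv (a.2 i))),
   ∑ i, ∑ j, ww i j • (- w11 (d0 (a.1 i)) (d0 (dv (b.2 j)))
     + w11 (d0 (b.1 j)) (d0 (dv (a.2 i))) + d1 (con (a.2 i) (b.2 j))))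

/-! ### Helper facts: the brackets take values in `Ev`, and satisfy the Jacobi identity -/

theorem d0_0 (f : Fn) : d0 f 0 = pd 0 f := rfl
theorem d0_1 (f : Fn) : d0 f 1 = pd 1 f := rfl
theorem d0_2 (f : Fn) : d0 f 2 = pd 2 f := rfl
theorem w11_0 (f g : Tri) : w11 f g 0 = f 1 * g 2 - f 2 * g 1 := rfl
theorem w11_1 (f g : Tri) : w11 f g 1 = f 2 * g 0 - f 0 * g 2 := rfl
theorem w11_2 (f g : Tri) : w11 f g 2 = f 0 * g 1 - f 1 * g 0 := rfl
theorem d1_0 (f : Tri) : d1 f 0 = pd 1 (f 2) - pd 2 (f 1) := rfl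
theorem d1_1 (f : Tri) : d1 f 1 = pd 2 (f 0) - pd 0 (f 2) := rfl
theorem d1_2 (f : Tri) : d1 f 2 = pd 0 (f 1) - pd 1 (f 0) := rfl

theorem ww_00 : ww 0 0 = 0 := rfl
theorem ww_01 : ww 0 1 = 1 := rfl
theorem ww_10 : ww 1 0 = -1 := rfl
theorem ww_11 : ww 1 1 = 0 := rfl
theorem tri_ext {f g : Tri} (h0 : f 0 = g 0) (h1 : f 1 = g 1) (h2 : f 2 = g 2) : f = g := by
  funext i; fin_cases i <;> assumption

/-- The Lie derivative of a `1`-form. -/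
def lie1 (X α : Tri) : Tri := fun i =>
  ap X (α i) + (α 0 * pd i (X 0) + α 1 * pd i (X 1) + α 2 * pd i (X 2))

theorem ap_add (X : Tri) (f g : Fn) : ap X (f + g) = ap X f + ap X g := by
  simp only [ap, pd_add]; ring
theorem ap_sub (X : Tri) (f g : Fn) : ap X (f - g) = ap X f - ap X g := by
  simp only [ap, pd_sub]; ring
theorem ap_neg (X : Tri) (f : Fn) : ap X (-f) = - ap X f := by
  simp only [ap, pd_neg]; ring
theorem ap_mul (X : Tri) (f g : Fn) : ap X (f * g) = f * ap X g + ap X f * g := by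
  simp only [ap, pd_mul]; ring
theorem ap_hf (X : Tri) : ap X hf = 0 := by simp only [ap, pd_hf]; ring
theorem ap_zero (X : Tri) : ap X 0 = 0 := by simp only [ap, pd_zero]; ring
theorem ap_one (X : Tri) : ap X 1 = 0 := by simp only [ap, pd, MvPowerSeries.pderiv_one]; ring
theorem ap_vbr (X Y : Tri) (f : Fn) : ap (vbr X Y) f = ap X (ap Y f) - ap Y (ap X f) := by
  simp only [ap, vbr, pd_add, pd_mul, pd10, pd20, pd21]; ring
theorem ap_w12 (X α σ : Tri) :
    ap X (w12 α σ) = w12 (lie1 X α) σ + w12 α (lie2 X σ) - dv X * w12 α σ := by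
  simp only [w12, lie1, lie2, vbr, dv, ap, pd_add, pd_mul]; ring

theorem d0_add (f g : Fn) : d0 (f + g) = d0 f + d0 g := by
  apply tri_ext <;> simp only [d0_0, d0_1, d0_2, pd_add, Pi.add_apply]
theorem d0_sub (f g : Fn) : d0 (f - g) = d0 f - d0 g := by
  apply tri_ext <;> simp only [d0_0, d0_1, d0_2, pd_sub, Pi.sub_apply]
theorem d0_neg (f : Fn) : d0 (-f) = - d0 f := by
  apply tri_ext <;> simp only [d0_0, d0_1, d0_2, pd_neg, Pi.neg_apply]
theorem d0_mul (f g : Fn) : d0 (f * g) = f • d0 g + g • d0 f := by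
  apply tri_ext <;> simp only [d0_0, d0_1, d0_2, pd_mul, Pi.add_apply, Pi.smul_apply, smul_eq_mul]
    <;> ring
theorem d0_hf : d0 hf = 0 := by
  apply tri_ext <;> simp only [d0_0, d0_1, d0_2, pd_hf, Pi.zero_apply]
theorem d0_zero : d0 0 = 0 := by
  apply tri_ext <;> simp only [d0_0, d0_1, d0_2, pd_zero, Pi.zero_apply]
theorem d0_ap (X : Tri) (f : Fn) : d0 (ap X f) = lie1 X (d0 f) := by
  apply tri_ext <;>
    simp only [lie1, ap, d0_0, d0_1, d0_2, pd_add, pd_mul, pd10, pd20, pd21] <;> ring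

theorem dv_add (X Y : Tri) : dv (X + Y) = dv X + dv Y := by
  simp only [dv, Pi.add_apply, pd_add]; ring
theorem dv_sub (X Y : Tri) : dv (X - Y) = dv X - dv Y := by
  simp only [dv, Pi.sub_apply, pd_sub]; ring
theorem dv_neg (X : Tri) : dv (-X) = - dv X := by
  simp only [dv, Pi.neg_apply, pd_neg]; ring
theorem dv_smul (f : Fn) (X : Tri) : dv (f • X) = w12 (d0 f) X + f * dv X := by
  simp only [dv, w12, d0_0, d0_1, d0_2, Pi.smul_apply, smul_eq_mul, pd_mul]; ring
theorem dv_vbr (X Y : Tri) : dv (vbr X Y) = ap X (dv Y) - ap Y (dv X) := by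
  simp only [dv, vbr, ap, pd_add, pd_sub, pd_mul, pd10, pd20, pd21]; ring
theorem dv_lie2 (X σ : Tri) : dv (lie2 X σ) = ap X (dv σ) + dv X * dv σ := by
  simp only [dv, lie2, vbr, ap, pd_add, pd_sub, pd_mul, pd10, pd20, pd21]; ring
theorem dv_w11 (f g : Fn) : dv (w11 (d0 f) (d0 g)) = 0 := by
  simp only [dv, w11_0, w11_1, w11_2, d0_0, d0_1, d0_2, pd_sub, pd_mul, pd10, pd20, pd21]; ring
theorem dv_d1 (α : Tri) : dv (d1 α) = 0 := by
  simp only [dv, d1_0, d1_1, d1_2, pd_sub, pd10, pd20, pd21]; ring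

theorem lie2_add (X σ τ : Tri) : lie2 X (σ + τ) = lie2 X σ + lie2 X τ := by
  funext i; simp only [lie2, vbr, ap, Pi.add_apply, pd_add]; ring
theorem lie2_sub (X σ τ : Tri) : lie2 X (σ - τ) = lie2 X σ - lie2 X τ := by
  funext i; simp only [lie2, vbr, ap, Pi.sub_apply, pd_sub]; ring
theorem lie2_neg (X σ : Tri) : lie2 X (-σ) = - lie2 X σ := by
  funext i; simp only [lie2, vbr, ap, Pi.neg_apply, pd_neg]; ring
theorem lie2_smul (X : Tri) (f : Fn) (σ : Tri) :
    lie2 X (f • σ) = ap X f • σ + f • lie2 X σ := by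
  funext i
  simp only [lie2, vbr, ap, Pi.smul_apply, Pi.add_apply, smul_eq_mul, pd_mul]; ring
theorem lie2_w11 (X α β : Tri) : lie2 X (w11 α β) = w11 (lie1 X α) β + w11 α (lie1 X β) := by
  apply tri_ext <;>
    simp only [lie2, lie1, vbr, ap, dv, w11_0, w11_1, w11_2, Pi.add_apply, pd_sub, pd_mul] <;> ring
theorem lie2_d1 (X α : Tri) : lie2 X (d1 α) = d1 (lie1 X α) := by
  apply tri_ext <;>
    simp only [lie2, lie1, vbr, ap, dv, d1_0, d1_1, d1_2, pd_add, pd_sub, pd_mul,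
      pd10, pd20, pd21] <;> ring
theorem lie2_vbr (X Y σ : Tri) :
    lie2 (vbr X Y) σ = lie2 X (lie2 Y σ) - lie2 Y (lie2 X σ) := by
  apply tri_ext <;>
    simp only [lie2, vbr, ap, dv, Pi.sub_apply, pd_add, pd_sub, pd_mul, pd10, pd20, pd21] <;> ring
theorem lie1_w11 (X σ τ : Tri) :
    lie1 X (w11 σ τ) = w11 (lie2 X σ) τ + w11 σ (lie2 X τ) - dv X • w11 σ τ := by
  apply tri_ext <;>
    simp only [lie1, lie2, vbr, ap, dv, w11_0, w11_1, w11_2, Pi.add_apply, Pi.sub_apply,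
      Pi.smul_apply, smul_eq_mul, pd_sub, pd_mul] <;> ring
theorem vbr_eq (X σ : Tri) : vbr X σ = lie2 X σ - dv X • σ := by
  funext i; simp only [lie2, Pi.sub_apply, Pi.smul_apply, smul_eq_mul]; ring
theorem lie2_closed (X ω : Tri) (h : dv ω = 0) : lie2 X ω = d1 (w11 ω X) := by
  have e : pd 2 (ω 2) = - pd 0 (ω 0) - pd 1 (ω 1) := by
    simp only [dv] at h; linear_combination h
  apply tri_ext <;>
    simp only [lie2, vbr, ap, dv, d1_0, d1_1, d1_2, w11_0, w11_1, w11_2, pd_sub, pd_mul, e] <;> ring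
theorem d1_add (α β : Tri) : d1 (α + β) = d1 α + d1 β := by
  apply tri_ext <;> simp only [d1_0, d1_1, d1_2, Pi.add_apply, pd_add] <;> ring
theorem d1_sub (α β : Tri) : d1 (α - β) = d1 α - d1 β := by
  apply tri_ext <;> simp only [d1_0, d1_1, d1_2, Pi.sub_apply, pd_sub] <;> ring
theorem d1_neg (α : Tri) : d1 (-α) = - d1 α := by
  apply tri_ext <;> simp only [d1_0, d1_1, d1_2, Pi.neg_apply, pd_neg] <;> ring
theorem d1_smul (f : Fn) (α : Tri) : d1 (f • α) = w11 (d0 f) α + f • d1 α := by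
  apply tri_ext <;> simp only [d1_0, d1_1, d1_2, d0_0, d0_1, d0_2, w11_0, w11_1, w11_2,
    Pi.smul_apply, Pi.add_apply, smul_eq_mul, pd_mul] <;> ring
theorem d1_d0 (f : Fn) : d1 (d0 f) = 0 := by
  apply tri_ext <;> simp only [d1_0, d1_1, d1_2, d0_0, d0_1, d0_2, pd10, pd20, pd21,
    Pi.zero_apply] <;> ring

theorem w11_add_left (α β γ : Tri) : w11 (α + β) γ = w11 α γ + w11 β γ := by
  apply tri_ext <;> simp only [w11_0, w11_1, w11_2, Pi.add_apply] <;> ring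
theorem w11_add_right (α β γ : Tri) : w11 γ (α + β) = w11 γ α + w11 γ β := by
  apply tri_ext <;> simp only [w11_0, w11_1, w11_2, Pi.add_apply] <;> ring
theorem w11_sub_left (α β γ : Tri) : w11 (α - β) γ = w11 α γ - w11 β γ := by
  apply tri_ext <;> simp only [w11_0, w11_1, w11_2, Pi.sub_apply] <;> ring
theorem w11_sub_right (α β γ : Tri) : w11 γ (α - β) = w11 γ α - w11 γ β := by
  apply tri_ext <;> simp only [w11_0, w11_1, w11_2, Pi.sub_apply] <;> ring
theorem w11_neg_left (α γ : Tri) : w11 (-α) γ = - w11 α γ := by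
  apply tri_ext <;> simp only [w11_0, w11_1, w11_2, Pi.neg_apply] <;> ring
theorem w11_neg_right (α γ : Tri) : w11 γ (-α) = - w11 γ α := by
  apply tri_ext <;> simp only [w11_0, w11_1, w11_2, Pi.neg_apply] <;> ring
theorem w11_smul_left (f : Fn) (α γ : Tri) : w11 (f • α) γ = f • w11 α γ := by
  apply tri_ext <;> simp only [w11_0, w11_1, w11_2, Pi.smul_apply, smul_eq_mul] <;> ring
theorem w11_smul_right (f : Fn) (α γ : Tri) : w11 γ (f • α) = f • w11 γ α := by
  apply tri_ext <;> simp only [w11_0, w11_1, w11_2, Pi.smul_apply, smul_eq_mul] <;> ring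
theorem w11_w11_right (α β γ : Tri) : w11 α (w11 β γ) = w12 γ α • β - w12 β α • γ := by
  apply tri_ext <;>
    simp only [w11_0, w11_1, w11_2, w12, Pi.smul_apply, Pi.sub_apply, smul_eq_mul] <;> ring
theorem w11_w11_left (α β γ : Tri) : w11 (w11 β γ) α = w12 β α • γ - w12 γ α • β := by
  apply tri_ext <;>
    simp only [w11_0, w11_1, w11_2, w12, Pi.smul_apply, Pi.sub_apply, smul_eq_mul] <;> ring

theorem d0_one : d0 1 = 0 := by
  apply tri_ext <;> simp only [d0_0, d0_1, d0_2, pd, MvPowerSeries.pderiv_one, Pi.zero_apply]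
theorem w12_add_left (α β σ : Tri) : w12 (α + β) σ = w12 α σ + w12 β σ := by
  simp only [w12, Pi.add_apply]; ring
theorem w12_sub_left (α β σ : Tri) : w12 (α - β) σ = w12 α σ - w12 β σ := by
  simp only [w12, Pi.sub_apply]; ring
theorem w12_neg_left (α σ : Tri) : w12 (-α) σ = - w12 α σ := by
  simp only [w12, Pi.neg_apply]; ring
theorem w12_smul_left (f : Fn) (α σ : Tri) : w12 (f • α) σ = f * w12 α σ := by
  simp only [w12, Pi.smul_apply, smul_eq_mul]; ring
theorem w12_add_right (α σ τ : Tri) : w12 α (σ + τ) = w12 α σ + w12 α τ := by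
  simp only [w12, Pi.add_apply]; ring
theorem w12_sub_right (α σ τ : Tri) : w12 α (σ - τ) = w12 α σ - w12 α τ := by
  simp only [w12, Pi.sub_apply]; ring
theorem w12_neg_right (α σ : Tri) : w12 α (-σ) = - w12 α σ := by
  simp only [w12, Pi.neg_apply]; ring
theorem w12_smul_right (f : Fn) (α σ : Tri) : w12 α (f • σ) = f * w12 α σ := by
  simp only [w12, Pi.smul_apply, smul_eq_mul]; ring
theorem w12_zero_left (σ : Tri) : w12 0 σ = 0 := by
  simp only [w12, Pi.zero_apply]; ring

theorem lie2_cartan (X σ : Tri) : lie2 X σ = d1 (w11 σ X) + dv σ • X := by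
  apply tri_ext <;>
    simp only [lie2, vbr, ap, dv, d1_0, d1_1, d1_2, w11_0, w11_1, w11_2, pd_sub, pd_mul,
      Pi.add_apply, Pi.smul_apply, smul_eq_mul] <;> ring
theorem w11_swap (α β : Tri) : w11 α β = - w11 β α := by
  apply tri_ext <;> simp only [w11_0, w11_1, w11_2, Pi.neg_apply] <;> ring
theorem ap_eq (X : Tri) (f : Fn) : ap X f = w12 (d0 f) X := by
  simp only [ap, w12, d0_0, d0_1, d0_2]; ring

theorem w12_comm (α β : Tri) : w12 α β = w12 β α := by simp only [w12]; ring
theorem w11_app (α β : Tri) (i : Fin 3) :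
    w11 α β i = α (i + 1) * β (i + 2) - α (i + 2) * β (i + 1) := by
  fin_cases i <;> rfl

/-- The embedding of functions into their field of fractions. -/
def toFrac : Fn →+* FractionRing Fn := algebraMap Fn (FractionRing Fn)
theorem toFrac_inj {f g : Fn} (h : toFrac f = toFrac g) : f = g :=
  IsFractionRing.injective Fn (FractionRing Fn) h
theorem charZero_frac : CharZero (FractionRing Fn) :=
  charZero_of_injective_ringHom (f := toFrac.comp (MvPowerSeries.C (σ := Fin 3) (R := ℂ)))
    (RingHom.injective _)
theorem toFrac_hf : toFrac hf = 1 / 2 := by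
  have h2 : (2 : FractionRing Fn) = toFrac 2 := (map_ofNat toFrac 2).symm
  have h : toFrac hf * 2 = 1 := by rw [h2, ← map_mul, hf_two, map_one]
  have h3 : (2 : FractionRing Fn) ≠ 0 := fun h0 => by rw [h0, mul_zero] at h; exact zero_ne_one h
  field_simp
  exact h
theorem toFrac_add (f g : Fn) : toFrac (f + g) = toFrac f + toFrac g := map_add _ _ _
theorem toFrac_sub (f g : Fn) : toFrac (f - g) = toFrac f - toFrac g := map_sub _ _ _
theorem toFrac_mul (f g : Fn) : toFrac (f * g) = toFrac f * toFrac g := map_mul _ _ _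
theorem toFrac_neg (f : Fn) : toFrac (-f) = - toFrac f := map_neg _ _
theorem toFrac_zero : toFrac 0 = 0 := map_zero _
theorem toFrac_one : toFrac 1 = 1 := map_one _

theorem eeFun_mem {x y : EvAmb} (hx : x ∈ evSub) (hy : y ∈ evSub) : eeFun x y ∈ evSub := by
  obtain ⟨X, A, ω⟩ := x
  obtain ⟨Y, B, η⟩ := y
  obtain ⟨h1, h2⟩ := hx
  obtain ⟨h3, h4⟩ := hy
  simp only at h1 h2 h3 h4
  have h1' : A 1 1 = - A 0 0 := by linear_combination h1
  have h3' : B 1 1 = - B 0 0 := by linear_combination h3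
  constructor
  · simp only [eeFun, Matrix.of_apply, Matrix.sub_apply, Matrix.mul_apply, Fin.sum_univ_two,
      ap_neg, h1', h3']
    ring
  · simp only [eeFun, Fin.sum_univ_two, dv_add, dv_sub, dv_lie2, dv_smul, dv_w11, h2, h4, ap_zero,
      d0_hf, w12_zero_left]
    ring

theorem ooFun_mem (a b : Od) : ooFun a b ∈ evSub := by
  obtain ⟨g, σ⟩ := a
  obtain ⟨h, τ⟩ := b
  constructor
  · simp only [ooFun, sy, ww_00, ww_01, ww_10, ww_11, Matrix.of_apply, Fin.sum_univ_two,
      Fin.isValue, if_true, zero_ne_one, one_ne_zero, if_false, ite_true, ite_false, reduceIte]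
    ring
  · simp only [ooFun, ww_00, ww_01, ww_10, ww_11, Fin.sum_univ_two, zero_smul, one_smul, neg_smul,
      dv_add, dv_sub, dv_neg, dv_w11, dv_d1, neg_zero, add_zero, zero_add]

theorem smul_C (c : ℂ) (f : Fn) : c • f = MvPowerSeries.C c * f := MvPowerSeries.smul_eq_C_mul _ _

theorem ooFun_comm (a b : Od) : ooFun a b = ooFun b a := by
  obtain ⟨g, σ⟩ := a
  obtain ⟨h, τ⟩ := b
  refine Prod.ext ?_ (Prod.ext ?_ ?_)
  · funext i
    simp only [ooFun, ww_00, ww_01, ww_10, ww_11, Fin.sum_univ_two, w11_app, Pi.add_apply,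
      Pi.sub_apply, Pi.neg_apply, Pi.smul_apply, smul_eq_mul]
    ring
  · ext1 p q
    simp only [ooFun, sy, Fin.sum_univ_two, Matrix.of_apply]
    ring
  · have s := fun i j => w11_swap (τ i) (σ j)
    funext i
    simp only [ooFun, ww_00, ww_01, ww_10, ww_11, Fin.sum_univ_two, con, s, d1_neg, w11_app,
      Pi.add_apply, Pi.sub_apply, Pi.neg_apply, Pi.smul_apply, smul_eq_mul]
    ring

theorem eeFun_skew (x y : EvAmb) : eeFun x y = - eeFun y x := by
  obtain ⟨X, A, ω⟩ := x
  obtain ⟨Y, B, η⟩ := y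
  refine Prod.ext ?_ (Prod.ext ?_ ?_)
  · funext i
    simp only [eeFun, vbr, Prod.fst_neg, Pi.neg_apply]
    ring
  · ext1 p q
    simp only [eeFun, Prod.fst_neg, Prod.snd_neg, Matrix.neg_apply, Matrix.of_apply,
      Matrix.sub_apply]
    ring
  · funext i
    simp only [eeFun, Fin.sum_univ_two, Prod.snd_neg, w11_app,
      Pi.add_apply, Pi.sub_apply, Pi.neg_apply, Pi.smul_apply, smul_eq_mul]
    ring

theorem eeFun_self (x : EvAmb) : eeFun x x = 0 := by
  obtain ⟨X, A, ω⟩ := x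
  refine Prod.ext ?_ (Prod.ext ?_ ?_)
  · funext i
    simp only [eeFun, vbr, Prod.fst_zero, Pi.zero_apply]
    ring
  · ext1 p q
    simp only [eeFun, Prod.fst_zero, Prod.snd_zero, Matrix.zero_apply, Matrix.of_apply,
      Matrix.sub_apply]
    ring
  · funext i
    simp only [eeFun, Fin.sum_univ_two, Prod.snd_zero, w11_app,
      Pi.add_apply, Pi.sub_apply, Pi.zero_apply, Pi.smul_apply, smul_eq_mul]
    ring

theorem eeFun_add (x y z : EvAmb) : eeFun x (y + z) = eeFun x y + eeFun x z := by
  obtain ⟨X, A, ω⟩ := x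
  obtain ⟨Y, B, η⟩ := y
  obtain ⟨Z, C, ζ⟩ := z
  refine Prod.ext ?_ (Prod.ext ?_ ?_)
  · funext i
    simp only [eeFun, vbr, ap, Prod.fst_add, Pi.add_apply, pd_add]
    ring
  · ext1 p q
    simp only [eeFun, ap, Prod.fst_add, Prod.snd_add, Matrix.add_apply, Matrix.of_apply,
      Matrix.sub_apply, Matrix.mul_apply, Fin.sum_univ_two, pd_add, Pi.add_apply]
    ring
  · funext i
    simp only [eeFun, lie2, vbr, ap, Fin.sum_univ_two, Prod.fst_add, Prod.snd_add, w11_app, dv_add,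
      d0_add, Matrix.add_apply, Pi.add_apply, Pi.sub_apply, Pi.smul_apply, smul_eq_mul, pd_add]
    ring

theorem eeFun_smul (c : ℂ) (x y : EvAmb) : eeFun x (c • y) = c • eeFun x y := by
  obtain ⟨X, A, ω⟩ := x
  obtain ⟨Y, B, η⟩ := y
  have hd : dv (c • Y) = MvPowerSeries.C c * dv Y := by
    simp only [dv, Pi.smul_apply, smul_C, pd_mul, pd_C]; ring
  have h0 : ∀ f, d0 (MvPowerSeries.C c * f) = fun i => MvPowerSeries.C c * d0 f i := by
    intro f
    apply tri_ext <;> simp only [d0_0, d0_1, d0_2, pd_mul, pd_C] <;> ring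
  refine Prod.ext ?_ (Prod.ext ?_ ?_)
  · funext i
    simp only [eeFun, vbr, ap, Prod.smul_fst, Pi.smul_apply, smul_C, pd_mul, pd_C]
    ring
  · ext1 p q
    simp only [eeFun, ap, Prod.smul_fst, Prod.smul_snd, Matrix.smul_apply, Matrix.of_apply,
      Matrix.sub_apply, Matrix.mul_apply, Fin.sum_univ_two, Pi.smul_apply, smul_C, pd_mul, pd_C]
    ring
  · funext i
    simp only [eeFun, lie2, vbr, ap, Fin.sum_univ_two, Prod.smul_fst, Prod.smul_snd, w11_app, hd,
      h0, Matrix.smul_apply, Pi.add_apply, Pi.sub_apply, Pi.smul_apply, smul_eq_mul, smul_C, pd_mul,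
      pd_C]
    ring

theorem eoFun_add_left (x y : EvAmb) (a : Od) : eoFun (x + y) a = eoFun x a + eoFun y a := by
  obtain ⟨X, A, ω⟩ := x
  obtain ⟨Y, B, η⟩ := y
  obtain ⟨g, σ⟩ := a
  refine Prod.ext ?_ ?_
  · funext i
    simp only [eoFun, ap, Fin.sum_univ_two, Prod.fst_add, Prod.snd_add, dv_add, Matrix.add_apply,
      Pi.add_apply]
    ring
  · funext i j
    simp only [eoFun, lie2, vbr, ap, Fin.sum_univ_two, Prod.fst_add, Prod.snd_add, w11_app, dv_add,
      d0_add, Matrix.add_apply, Pi.add_apply, Pi.sub_apply, Pi.smul_apply, smul_eq_mul, pd_add]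
    ring

theorem eoFun_add_right (x : EvAmb) (a b : Od) : eoFun x (a + b) = eoFun x a + eoFun x b := by
  obtain ⟨X, A, ω⟩ := x
  obtain ⟨g, σ⟩ := a
  obtain ⟨h, τ⟩ := b
  refine Prod.ext ?_ ?_
  · funext i
    simp only [eoFun, ap, Fin.sum_univ_two, Prod.fst_add, Prod.snd_add, pd_add, Pi.add_apply]
    ring
  · funext i j
    simp only [eoFun, lie2, vbr, ap, Fin.sum_univ_two, Prod.fst_add, Prod.snd_add, w11_app,
      d0_add, Pi.add_apply, Pi.sub_apply, Pi.smul_apply, smul_eq_mul, pd_add]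
    ring

theorem eoFun_smul_left (c : ℂ) (x : EvAmb) (a : Od) : eoFun (c • x) a = c • eoFun x a := by
  obtain ⟨X, A, ω⟩ := x
  obtain ⟨g, σ⟩ := a
  have hd : dv (c • X) = MvPowerSeries.C c * dv X := by
    simp only [dv, Pi.smul_apply, smul_C, pd_mul, pd_C]; ring
  have h0 : ∀ f, d0 (MvPowerSeries.C c * f) = fun i => MvPowerSeries.C c * d0 f i := by
    intro f
    apply tri_ext <;> simp only [d0_0, d0_1, d0_2, pd_mul, pd_C] <;> ring
  refine Prod.ext ?_ ?_
  · funext i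
    simp only [eoFun, ap, Fin.sum_univ_two, Prod.smul_fst, Prod.smul_snd, hd, Matrix.smul_apply,
      Pi.smul_apply, smul_C]
    ring
  · funext i j
    simp only [eoFun, lie2, vbr, ap, Fin.sum_univ_two, Prod.smul_fst, Prod.smul_snd, w11_app, hd,
      h0, Matrix.smul_apply, Pi.add_apply, Pi.sub_apply, Pi.smul_apply, smul_eq_mul, smul_C, pd_mul,
      pd_C]
    ring

theorem eoFun_smul_right (c : ℂ) (x : EvAmb) (a : Od) : eoFun x (c • a) = c • eoFun x a := by
  obtain ⟨X, A, ω⟩ := x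
  obtain ⟨g, σ⟩ := a
  have h0 : ∀ f, d0 (MvPowerSeries.C c * f) = fun i => MvPowerSeries.C c * d0 f i := by
    intro f
    apply tri_ext <;> simp only [d0_0, d0_1, d0_2, pd_mul, pd_C] <;> ring
  refine Prod.ext ?_ ?_
  · funext i
    simp only [eoFun, ap, Fin.sum_univ_two, Prod.smul_fst, Prod.smul_snd,
      Pi.smul_apply, smul_C, pd_mul, pd_C]
    ring
  · funext i j
    simp only [eoFun, lie2, vbr, ap, Fin.sum_univ_two, Prod.smul_fst, Prod.smul_snd, w11_app,
      h0, Pi.add_apply, Pi.sub_apply, Pi.smul_apply, smul_eq_mul, smul_C, pd_mul, pd_C]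
    ring

theorem ooFun_add (a b c : Od) : ooFun a (b + c) = ooFun a b + ooFun a c := by
  obtain ⟨g, σ⟩ := a
  obtain ⟨h, τ⟩ := b
  obtain ⟨k, υ⟩ := c
  refine Prod.ext ?_ (Prod.ext ?_ ?_)
  · funext i
    simp only [ooFun, Fin.sum_univ_two, w11_app, d0_add, Prod.fst_add, Prod.snd_add, Pi.add_apply,
      Pi.sub_apply, Pi.neg_apply, Pi.smul_apply, smul_eq_mul]
    ring
  · ext1 p q
    simp only [ooFun, Fin.sum_univ_two, Matrix.of_apply, Matrix.add_apply, w12, d0_add, dv_add,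
      Prod.fst_add, Prod.snd_add, Pi.add_apply]
    ring
  · funext i
    simp only [ooFun, Fin.sum_univ_two, con, w11_add_right, d1_add, w11_app, d0_add, dv_add,
      Prod.fst_add, Prod.snd_add, Pi.add_apply, Pi.sub_apply, Pi.neg_apply, Pi.smul_apply,
      smul_eq_mul]
    ring

theorem ooFun_smul (c : ℂ) (a b : Od) : ooFun a (c • b) = c • ooFun a b := by
  obtain ⟨g, σ⟩ := a
  obtain ⟨h, τ⟩ := b
  have hd : ∀ Y : Tri, dv (c • Y) = MvPowerSeries.C c * dv Y := by
    intro Y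
    simp only [dv, Pi.smul_apply, smul_C, pd_mul, pd_C]; ring
  have h0 : ∀ f, d0 (MvPowerSeries.C c * f) = fun i => MvPowerSeries.C c * d0 f i := by
    intro f
    apply tri_ext <;> simp only [d0_0, d0_1, d0_2, pd_mul, pd_C] <;> ring
  have h1 : ∀ α β : Tri, d1 (w11 α (c • β)) = fun i => MvPowerSeries.C c * d1 (w11 α β) i := by
    intro α β
    apply tri_ext <;> simp only [d1_0, d1_1, d1_2, w11_0, w11_1, w11_2, Pi.smul_apply, smul_C,
      pd_sub, pd_mul, pd_C] <;> ring
  refine Prod.ext ?_ (Prod.ext ?_ ?_)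
  · funext i
    simp only [ooFun, Fin.sum_univ_two, w11_app, h0, Prod.smul_fst, Prod.smul_snd, Pi.add_apply,
      Pi.sub_apply, Pi.neg_apply, Pi.smul_apply, smul_eq_mul, smul_C]
    ring
  · ext1 p q
    simp only [ooFun, Fin.sum_univ_two, Matrix.of_apply, Matrix.smul_apply, w12, h0, hd,
      Prod.smul_fst, Prod.smul_snd, Pi.smul_apply, smul_C]
    ring
  · funext i
    simp only [ooFun, Fin.sum_univ_two, con, h1, w11_app, h0, hd,
      Prod.smul_fst, Prod.smul_snd, Pi.add_apply, Pi.sub_apply, Pi.neg_apply, Pi.smul_apply,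
      smul_eq_mul, smul_C]
    ring

theorem vbr_jac (X Y Z : Tri) : vbr X (vbr Y Z) = vbr (vbr X Y) Z + vbr Y (vbr X Z) := by
  funext i
  simp only [vbr, ap, pd_add, pd_sub, pd_mul, pd10, pd20, pd21, Pi.add_apply]
  ring


theorem jee3 (x y z : EvAmb) (hx : x ∈ evSub) (hy : y ∈ evSub) (hz : z ∈ evSub) :
    eeFun x (eeFun y z) = eeFun (eeFun x y) z + eeFun y (eeFun x z) := by
  obtain ⟨X, A, ω⟩ := x
  obtain ⟨Y, B, η⟩ := y
  obtain ⟨Z, C, ζ⟩ := z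
  refine Prod.ext (vbr_jac X Y Z) (Prod.ext ?_ ?_)
  · ext1 i j
    simp only [eeFun, ap_vbr, ap_add, ap_sub, ap_mul, Prod.fst_add, Prod.snd_add,
      Matrix.add_apply, Matrix.sub_apply, Matrix.of_apply, Matrix.mul_apply, Fin.sum_univ_two]
    ring
  · simp only [eeFun, lie2_vbr, lie2_add, lie2_sub, lie2_smul, lie2_w11, ap_hf, dv_vbr,
      d0_add, d0_sub, d0_mul, d0_ap, Prod.fst_add, Prod.snd_add,
      Matrix.add_apply, Matrix.sub_apply, Matrix.of_apply, Matrix.mul_apply, Fin.sum_univ_two]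
    funext i
    simp only [w11_app, Pi.add_apply, Pi.sub_apply, Pi.smul_apply, smul_eq_mul]
    ring

theorem jeeo3 (x y : EvAmb) (a : Od) (hx : x ∈ evSub) (hy : y ∈ evSub) :
    eoFun x (eoFun y a) = eoFun (eeFun x y) a + eoFun y (eoFun x a) := by
  obtain ⟨X, A, ω⟩ := x
  obtain ⟨Y, B, η⟩ := y
  obtain ⟨g, σ⟩ := a
  obtain ⟨h1, h2⟩ := hx
  obtain ⟨h3, h4⟩ := hy
  simp only at h1 h2 h3 h4
  have h1' : A 1 1 = - A 0 0 := by linear_combination h1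
  have h3' : B 1 1 = - B 0 0 := by linear_combination h3
  refine Prod.ext ?_ ?_
  · funext i
    simp only [eeFun, eoFun, ap_vbr, ap_add, ap_sub, ap_mul, ap_hf, dv_vbr, Prod.fst_add,
      Prod.snd_add, Pi.add_apply,
      Matrix.add_apply, Matrix.sub_apply, Matrix.of_apply, Matrix.mul_apply, Fin.sum_univ_two]
    ring
  · have key : ∀ i, (eoFun (X, A, ω) (eoFun (Y, B, η) (g, σ))).2 i =
        (eoFun (eeFun (X, A, ω) (Y, B, η)) (g, σ) + eoFun (Y, B, η) (eoFun (X, A, ω) (g, σ))).2 i := by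
      rw [Fin.forall_fin_two]
      constructor
      · simp only [eeFun, eoFun, ap_vbr, ap_add, ap_sub, ap_mul, ap_hf, dv_vbr, Prod.fst_add,
          lie2_vbr, lie2_add, lie2_sub, lie2_smul, lie2_w11,
          d0_add, d0_sub, d0_mul, d0_ap, d0_hf, d0_neg, ap_neg, Prod.snd_add, Pi.add_apply, h1', h3',
          Matrix.add_apply, Matrix.sub_apply, Matrix.of_apply, Matrix.mul_apply, Fin.sum_univ_two]
        funext i
        simp only [w11_app, Pi.add_apply, Pi.sub_apply, Pi.smul_apply, smul_eq_mul,
            Pi.zero_apply, Pi.neg_apply]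
        linear_combination (hf * g 0 * (d0 (dv Y) (i + 1) * d0 (dv X) (i + 2)
          - d0 (dv Y) (i + 2) * d0 (dv X) (i + 1))) * hf_two
      · simp only [eeFun, eoFun, ap_vbr, ap_add, ap_sub, ap_mul, ap_hf, dv_vbr, Prod.fst_add,
          lie2_vbr, lie2_add, lie2_sub, lie2_smul, lie2_w11,
          d0_add, d0_sub, d0_mul, d0_ap, d0_hf, d0_neg, ap_neg, Prod.snd_add, Pi.add_apply, h1', h3',
          Matrix.add_apply, Matrix.sub_apply, Matrix.of_apply, Matrix.mul_apply, Fin.sum_univ_two]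
        funext i
        simp only [w11_app, Pi.add_apply, Pi.sub_apply, Pi.smul_apply, smul_eq_mul,
            Pi.zero_apply, Pi.neg_apply]
        linear_combination (hf * g 1 * (d0 (dv Y) (i + 1) * d0 (dv X) (i + 2)
          - d0 (dv Y) (i + 2) * d0 (dv X) (i + 1))) * hf_two
    exact funext key

set_option maxHeartbeats 4000000 in
theorem jeoo1 (x : EvAmb) (a b : Od) (hx : x ∈ evSub) :
    (eeFun x (ooFun a b)).1 = (ooFun (eoFun x a) b + ooFun a (eoFun x b)).1 := by
  have := charZero_frac
  obtain ⟨X, A, ω⟩ := x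
  obtain ⟨g, σ⟩ := a
  obtain ⟨h, τ⟩ := b
  obtain ⟨h1, h2⟩ := hx
  simp only at h1 h2
  have h1' : A 1 1 = - A 0 0 := by linear_combination h1
  simp only [eeFun, eoFun, ooFun, ww_00, ww_01, ww_10, ww_11, Fin.sum_univ_two, zero_smul,
      zero_add, add_zero, one_smul, neg_smul, vbr_eq, lie2_add, lie2_sub, lie2_neg, lie2_smul,
      lie2_w11, dv_add, dv_sub, dv_neg, dv_w11, dv_smul, d0_add, d0_sub, d0_mul, d0_ap, d0_hf,
      d0_neg, h1', Prod.fst_add, Prod.snd_add, Pi.add_apply]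
  funext i
  · simp only [w11_app, Pi.add_apply, Pi.sub_apply, Pi.smul_apply, smul_eq_mul, Pi.zero_apply, Pi.neg_apply]
    apply toFrac_inj
    simp only [toFrac_add, toFrac_sub, toFrac_mul, toFrac_neg, toFrac_zero, toFrac_one, toFrac_hf]
    ring

set_option maxHeartbeats 4000000 in
theorem jeoo2 (x : EvAmb) (a b : Od) (hx : x ∈ evSub) :
    ∀ i j, (eeFun x (ooFun a b)).2.1 i j = (ooFun (eoFun x a) b + ooFun a (eoFun x b)).2.1 i j := by
  have := charZero_frac
  obtain ⟨X, A, ω⟩ := x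
  obtain ⟨g, σ⟩ := a
  obtain ⟨h, τ⟩ := b
  obtain ⟨h1, h2⟩ := hx
  simp only at h1 h2
  have h1' : A 1 1 = - A 0 0 := by linear_combination h1
  simp only [Fin.forall_fin_two]
  refine ⟨⟨?_, ?_⟩, ⟨?_, ?_⟩⟩
  all_goals
    simp only [eeFun, eoFun, ooFun, sy, ww_00, ww_01, ww_10, ww_11, Fin.sum_univ_two, h1',
          Matrix.add_apply, Matrix.sub_apply, Matrix.of_apply, Matrix.mul_apply, Prod.fst_add,
          Prod.snd_add, Fin.isValue, if_true, zero_ne_one, one_ne_zero, if_false, ite_true, ite_false, reduceIte, zero_smul, one_smul, neg_smul, zero_add, add_zero, mul_zero, zero_mul, mul_one, mul_neg, neg_mul, neg_zero,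
          ap_add, ap_sub, ap_neg, ap_mul, ap_hf, ap_zero, ap_one, ap_w12, dv_add, dv_sub, dv_neg, dv_smul, dv_lie2, dv_w11,
          d0_add, d0_sub, d0_mul, d0_ap, d0_hf, d0_neg, h2]
    simp only [ap, w12, d0_0, d0_1, d0_2, w11_0, w11_1, w11_2, Pi.add_apply, Pi.sub_apply, Pi.smul_apply, smul_eq_mul, Pi.zero_apply, Pi.neg_apply]
    apply toFrac_inj
    simp only [toFrac_add, toFrac_sub, toFrac_mul, toFrac_neg, toFrac_zero, toFrac_one, toFrac_hf]
    ring

set_option maxRecDepth 10000 in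
set_option maxHeartbeats 4000000 in
theorem jeoo3 (x : EvAmb) (a b : Od) (hx : x ∈ evSub) :
    (eeFun x (ooFun a b)).2.2 = (ooFun (eoFun x a) b + ooFun a (eoFun x b)).2.2 := by
  have := charZero_frac
  obtain ⟨X, A, ω⟩ := x
  obtain ⟨g, σ⟩ := a
  obtain ⟨h, τ⟩ := b
  obtain ⟨h1, h2⟩ := hx
  simp only at h1 h2
  have h1' : A 1 1 = - A 0 0 := by linear_combination h1
  have s0 := w11_swap ω (σ 0)
  have s1 := w11_swap ω (σ 1)
  simp only [eeFun, eoFun, ooFun, ww_00, ww_01, ww_10, ww_11, Fin.sum_univ_two, zero_smul,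
      zero_add, add_zero, one_smul, neg_smul, con, lie2_add, lie2_sub, lie2_neg, lie2_smul, 
      lie2_w11, lie2_d1, lie1_w11, lie2_closed _ _ h2, dv_add, dv_sub, dv_neg, dv_w11, dv_smul, dv_lie2, d0_add, d0_sub, d0_mul, d0_ap, d0_hf,
      d0_neg, d0_zero, h1', h2, Prod.fst_add, Prod.snd_add, Pi.add_apply, sy, 
      Matrix.add_apply, Matrix.sub_apply, Matrix.of_apply, Matrix.mul_apply, Fin.isValue, if_true, zero_ne_one, one_ne_zero, if_false, ite_true, ite_false, reduceIte, w11_add_left, w11_add_right, w11_sub_left, w11_sub_right, w11_smul_left, w11_smul_right, w11_neg_left, w11_neg_right, w11_w11_right, w11_w11_left, s0, s1, d1_add, d1_sub, d1_neg, d1_smul, d1_d0, d0_one, w12_add_left, w12_sub_left, w12_neg_left, w12_smul_left, w12_add_right, w12_sub_right, w12_neg_right, w12_smul_right, w12_zero_left, mul_zero, zero_mul, smul_zero, mul_one, mul_neg, neg_mul, neg_zero]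
  funext i
  · simp only [w11_app, Pi.add_apply, Pi.sub_apply, Pi.smul_apply, smul_eq_mul, Pi.zero_apply, Pi.neg_apply]
    apply toFrac_inj
    simp only [toFrac_add, toFrac_sub, toFrac_mul, toFrac_neg, toFrac_zero, toFrac_one, toFrac_hf]
    ring

set_option maxRecDepth 10000 in
set_option maxHeartbeats 4000000 in
theorem jooo1 (a b c : Od) : ∀ i,
    (eoFun (ooFun a b) c + eoFun (ooFun b c) a + eoFun (ooFun c a) b).1 i = 0 := by
  have := charZero_frac
  obtain ⟨g, σ⟩ := a
  obtain ⟨h, τ⟩ := b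
  obtain ⟨k, υ⟩ := c
  simp only [Fin.forall_fin_two]
  constructor
  all_goals
    simp only [eoFun, ooFun, sy, ww_00, ww_01, ww_10, ww_11, Fin.sum_univ_two, con, zero_smul, one_smul, neg_smul, smul_zero,
      zero_add, add_zero, neg_zero, mul_zero, zero_mul, mul_one, mul_neg, neg_mul, zero_sub, sub_zero,
      Prod.fst_add, Prod.snd_add, Pi.add_apply, Matrix.of_apply, Fin.isValue, if_true, zero_ne_one, one_ne_zero, if_false, ite_true, ite_false, reduceIte,
      dv_add, dv_sub, dv_neg, dv_w11, dv_smul, d0_add, d0_sub, d0_mul, d0_hf, d0_neg, d0_zero, d0_one,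
      w12_add_left, w12_sub_left, w12_neg_left, w12_smul_left, w12_add_right, w12_sub_right, w12_neg_right, w12_smul_right, w12_zero_left, ap_eq]
    simp only [w12, w11_0, w11_1, w11_2, Pi.add_apply, Pi.sub_apply, Pi.smul_apply, smul_eq_mul, Pi.zero_apply, Pi.neg_apply]
    apply toFrac_inj
    simp only [toFrac_add, toFrac_sub, toFrac_mul, toFrac_neg, toFrac_zero, toFrac_one, toFrac_hf]
    ring

set_option maxRecDepth 10000 in
set_option maxHeartbeats 4000000 in
theorem jooo2 (a b c : Od) : ∀ i,
    (eoFun (ooFun a b) c + eoFun (ooFun b c) a + eoFun (ooFun c a) b).2 i = 0 := by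
  have := charZero_frac
  obtain ⟨g, σ⟩ := a
  obtain ⟨h, τ⟩ := b
  obtain ⟨k, υ⟩ := c
  have s1 := fun i j => w11_swap (τ i) (σ j)
  have s2 := fun i j => w11_swap (υ i) (σ j)
  have s3 := fun i j => w11_swap (υ i) (τ j)
  have t1 := fun i f => w12_comm (σ i) (d0 f)
  have t2 := fun i f => w12_comm (τ i) (d0 f)
  have t3 := fun i f => w12_comm (υ i) (d0 f)
  simp only [Fin.forall_fin_two]
  constructor
  all_goals
    simp only [eoFun, ooFun, sy, ww_00, ww_01, ww_10, ww_11, Fin.sum_univ_two, con, zero_smul, one_smul, neg_smul, smul_zero,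
      zero_add, add_zero, neg_zero, mul_zero, zero_mul, mul_one, mul_neg, neg_mul, zero_sub, sub_zero,
      Prod.fst_add, Prod.snd_add, Pi.add_apply, Matrix.of_apply, Fin.isValue, if_true, zero_ne_one, one_ne_zero, if_false, ite_true, ite_false, reduceIte,
      dv_add, dv_sub, dv_neg, dv_w11, dv_smul, d0_add, d0_sub, d0_mul, d0_hf, d0_neg, d0_zero, d0_one,
      w12_add_left, w12_sub_left, w12_neg_left, w12_smul_left, w12_add_right, w12_sub_right, w12_neg_right, w12_smul_right, w12_zero_left, lie2_cartan, w11_add_left, w11_add_right, w11_sub_left, w11_sub_right, w11_smul_left, w11_smul_right, w11_neg_left, w11_neg_right, w11_w11_right, w11_w11_left, s1, s2, s3, t1, t2, t3, d1_add, d1_sub, d1_neg, d1_smul, d1_d0]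
    funext i
    · simp only [w11_app, Pi.add_apply, Pi.sub_apply, Pi.smul_apply, smul_eq_mul, Pi.zero_apply, Pi.neg_apply]
      apply toFrac_inj
      simp only [toFrac_add, toFrac_sub, toFrac_mul, toFrac_neg, toFrac_zero, toFrac_one, toFrac_hf]
      ring

/-! ### The Lie superalgebra and its subalgebra `L₀` -/

/-- The exceptional Lie superalgebra `E(3,8)`. -/
def L : LieSuperalgebra Ev Od where
  ee := LinearMap.mk₂ ℂ (fun x y => ⟨eeFun x y, eeFun_mem x.2 y.2⟩)
    (fun x y z => Subtype.ext (by
      change eeFun (x + y : EvAmb) z = eeFun x z + eeFun y z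
      rw [eeFun_skew, eeFun_add, neg_add, ← eeFun_skew, ← eeFun_skew]))
    (fun c x y => Subtype.ext (by
      change eeFun (c • x : EvAmb) y = c • eeFun x y
      rw [eeFun_skew, eeFun_smul, ← smul_neg, ← eeFun_skew]))
    (fun x y z => Subtype.ext (eeFun_add x y z))
    (fun c x y => Subtype.ext (eeFun_smul c x y))
  eo := LinearMap.mk₂ ℂ (fun x a => eoFun x a)
    (fun x y a => eoFun_add_left x y a) (fun c x a => eoFun_smul_left c x a)
    (fun x a b => eoFun_add_right x a b) (fun c x a => eoFun_smul_right c x a)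
  oo := LinearMap.mk₂ ℂ (fun a b => ⟨ooFun a b, ooFun_mem a b⟩)
    (fun a b c => Subtype.ext (by
      change ooFun (a + b) c = ooFun a c + ooFun b c
      rw [ooFun_comm, ooFun_add, ooFun_comm c, ooFun_comm c]))
    (fun c a b => Subtype.ext (by
      change ooFun (c • a) b = c • ooFun a b
      rw [ooFun_comm, ooFun_smul, ooFun_comm b]))
    (fun a b c => Subtype.ext (ooFun_add a b c))
    (fun c a b => Subtype.ext (ooFun_smul c a b))
  ee_self x := Subtype.ext (eeFun_self x)
  oo_comm a b := Subtype.ext (ooFun_comm a b)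
  jacobi_eee x y z := Subtype.ext (jee3 x y z x.2 y.2 z.2)
  jacobi_eeo x y a := jeeo3 x y a x.2 y.2
  jacobi_eoo x a b := Subtype.ext (Prod.ext (jeoo1 x a b x.2)
    (Prod.ext (Matrix.ext (jeoo2 x a b x.2)) (jeoo3 x a b x.2)))
  jacobi_ooo a b c := Prod.ext (funext (jooo1 a b c)) (funext (jooo2 a b c))

/-- The value of a function at the origin. -/
def ev0 : Fn →+* ℂ := MvPowerSeries.constantCoeff

theorem ev0_C (c : ℂ) : ev0 (MvPowerSeries.C c) = c := MvPowerSeries.constantCoeff_C c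

/-- The subalgebra `L₀ = ⊕_{j ≥ 0} 𝔤_j`. In the grading `deg xᵢ = deg dxᵢ = -deg ∂ᵢ = 2`,
`deg ε^± = -3`, `deg sl₂(ℂ) = 0`, a monomial of polynomial degree `n` has degree `2n - 2` in `W₃`,
`2n` in `sl₂(Ω⁰)`, `2n + 4` in `dΩ¹`, `2n - 3` in `Ω⁰ ⊗ ℂ²`, `2n + 1` in `Ω² ⊗ ℂ²`. So `(X, A, ω)`
is in `L₀` iff `X` vanishes at the origin, and `(g, σ)` is in `L₀` iff `g` vanishes to second order
at the origin. -/
def L0 : L.Sub where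
  even :=
    { carrier := {x | ∀ i, ev0 (x.1.1 i) = 0}
      add_mem' := fun {x y} hx hy i => by
        change ev0 (x.1.1 i + y.1.1 i) = 0
        rw [map_add]; rw [hx i, hy i, add_zero]
      zero_mem' := fun i => map_zero _
      smul_mem' := fun c x hx i => by
        change ev0 (c • x.1.1 i) = 0
        rw [smul_C, map_mul]; rw [hx i, mul_zero] }
  odd :=
    { carrier := {a | ∀ i, ev0 (a.1 i) = 0 ∧ ∀ j, ev0 (pd j (a.1 i)) = 0}
      add_mem' := fun {a b} ha hb i => by
        change ev0 (a.1 i + b.1 i) = 0 ∧ ∀ j, ev0 (pd j (a.1 i + b.1 i)) = 0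
        refine ⟨?_, fun j => ?_⟩
        · rw [map_add, (ha i).1, (hb i).1, add_zero]
        · rw [pd_add, map_add, (ha i).2, (hb i).2, add_zero]
      zero_mem' := fun i => ⟨map_zero _, fun j => by
        change ev0 (pd j 0) = 0
        rw [pd_zero]; exact map_zero _⟩
      smul_mem' := fun c a ha i => by
        change ev0 (c • a.1 i) = 0 ∧ ∀ j, ev0 (pd j (c • a.1 i)) = 0
        refine ⟨?_, fun j => ?_⟩
        · rw [smul_C, map_mul, (ha i).1, mul_zero]
        · rw [pd_smul, smul_C, map_mul, (ha i).2, mul_zero] }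
  ee_mem x hx y hy i := by
    change ev0 (vbr x.1.1 y.1.1 i) = 0
    simp only [vbr, ap, map_add, map_sub, map_mul, hx _, hy _, zero_mul, add_zero, sub_zero]
  eo_mem x hx a ha i := by
    obtain ⟨⟨X, A, ω⟩, hm⟩ := x
    obtain ⟨g, σ⟩ := a
    have hx' : ∀ i, ev0 (X i) = 0 := hx
    have h0 : ∀ i, ev0 (g i) = 0 := fun i => (ha i).1
    have h1 : ∀ i j, ev0 (pd j (g i)) = 0 := fun i => (ha i).2
    change ev0 (ap X (g i) - hf * dv X * g i + ∑ j, A i j * g j) = 0 ∧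
      ∀ k, ev0 (pd k (ap X (g i) - hf * dv X * g i + ∑ j, A i j * g j)) = 0
    refine ⟨?_, fun k => ?_⟩
    · simp only [ap, Fin.sum_univ_two, map_add, map_sub, map_mul, h0, h1, hx', mul_zero, zero_mul,
        add_zero, sub_zero]
    · simp only [ap, Fin.sum_univ_two, pd_add, pd_sub, pd_mul, map_add, map_sub, map_mul, h0, h1,
        hx', mul_zero, zero_mul, add_zero, sub_zero]
  oo_mem a ha b hb i := by
    obtain ⟨g, σ⟩ := a
    obtain ⟨h, τ⟩ := b
    have h0 : ∀ i, ev0 (g i) = 0 := fun i => (ha i).1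
    have h1 : ∀ i j, ev0 (pd j (g i)) = 0 := fun i => (ha i).2
    have h2 : ∀ i, ev0 (h i) = 0 := fun i => (hb i).1
    have h4 : ∀ i j, ev0 (d0 (g i) j) = 0 := by
      intro i j; fin_cases j <;> exact h1 _ _
    change ev0 ((ooFun (g, σ) (h, τ)).1 i) = 0
    simp only [ooFun, Fin.sum_univ_two, w11_app, Pi.add_apply, Pi.sub_apply, Pi.neg_apply,
      Pi.smul_apply, smul_eq_mul, map_add, map_sub, map_mul, map_neg, h0, h2, h4, mul_zero,
      zero_mul, add_zero, sub_zero, neg_zero]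

/-- The matrix `a` of the linear part `∑ aᵢⱼ xᵢ ∂ⱼ` of a vector field. -/
def lin (X : Tri) : Matrix (Fin 3) (Fin 3) ℂ := Matrix.of fun i j => ev0 (pd i (X j))

/-! ## The Weyl algebra and its modules `V_X` -/

/-- Indices of the variables `x₁, x₂, x₃, z₊, z₋`. -/
abbrev Idx := Fin 3 ⊕ Fin 2

/-- The `10`-dimensional space `W`; the first component contains the coordinates along
`x₁, x₂, x₃, z₊, z₋`, the second one those along `∂₁, ∂₂, ∂₃, ∂₊, ∂₋`. -/
abbrev W := (Idx → ℂ) × (Idx → ℂ)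

/-- The symplectic form on `W`: `(∂ᵢ, xⱼ) = -(xⱼ, ∂ᵢ) = δᵢⱼ`, `(∂ₐ, z_b) = -(z_b, ∂ₐ) = δ_{ab}`,
and all other pairings of basis vectors are zero. -/
def symp (v w : W) : ℂ := ∑ i, (v.2 i * w.1 i - v.1 i * w.2 i)

/-- The defining relations `v w - w v = (v, w)` of the Heisenberg algebra. -/
inductive HRel : TensorAlgebra ℂ W → TensorAlgebra ℂ W → Prop
  | comm (v w : W) : HRel
      (TensorAlgebra.ι ℂ v * TensorAlgebra.ι ℂ w - TensorAlgebra.ι ℂ w * TensorAlgebra.ι ℂ v)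
      (algebraMap ℂ _ (symp v w))

/-- The Heisenberg algebra `H = T(W) / (v w - w v - (v, w))`. -/
def H : Type := RingQuot HRel

instance : Ring H := inferInstanceAs (Ring (RingQuot HRel))
instance : Algebra ℂ H := inferInstanceAs (Algebra ℂ (RingQuot HRel))

/-- The canonical map `W → H`. -/
def ιH : W →ₗ[ℂ] H := (RingQuot.mkAlgHom ℂ HRel).toLinearMap ∘ₗ TensorAlgebra.ι ℂ

/-- The basis vectors `x₁, x₂, x₃, z₊, z₋` of `W`. -/
def wq (i : Idx) : W := (Pi.single i 1, 0)

/-- The basis vectors `∂₁, ∂₂, ∂₃, ∂₊, ∂₋` of `W`. -/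
def wp (i : Idx) : W := (0, Pi.single i 1)

/-- The elements `x₁, x₂, x₃, z₊, z₋` of `H`. -/
def q (i : Idx) : H := ιH (wq i)

/-- The elements `∂₁, ∂₂, ∂₃, ∂₊, ∂₋` of `H`. -/
def p (i : Idx) : H := ιH (wp i)

/-- The four types of modules. -/
inductive Ty
  | A | B | C | D

/-- The Lagrangian subspaces `L_A = ⟨xᵢ, zₐ⟩`, `L_B = ⟨xᵢ, ∂ₐ⟩`, `L_C = ⟨∂ᵢ, zₐ⟩`,
`L_D = ⟨∂ᵢ, ∂ₐ⟩` of `W`. -/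
def lagr : Ty → Submodule ℂ W
  | .A => Submodule.span ℂ
      ((Set.range fun i : Fin 3 => wq (.inl i)) ∪ Set.range fun a : Fin 2 => wq (.inr a))
  | .B => Submodule.span ℂ
      ((Set.range fun i : Fin 3 => wq (.inl i)) ∪ Set.range fun a : Fin 2 => wp (.inr a))
  | .C => Submodule.span ℂ
      ((Set.range fun i : Fin 3 => wp (.inl i)) ∪ Set.range fun a : Fin 2 => wq (.inr a))
  | .D => Submodule.span ℂ
      ((Set.range fun i : Fin 3 => wp (.inl i)) ∪ Set.range fun a : Fin 2 => wp (.inr a))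

/-- The type of the transversal Lagrangian subspace: `L'_A = L_D`, `L'_B = L_C`, `L'_C = L_B`,
`L'_D = L_A`. -/
def Ty.opp : Ty → Ty
  | .A => .D
  | .B => .C
  | .C => .B
  | .D => .A

/-- The `H`-module `V_X = H / (L'_X)`, where `(L'_X)` is the left ideal generated by `L'_X`. -/
abbrev VX (X : Ty) : Type := H ⧸ Submodule.span H (ιH '' (lagr X.opp : Set W))

/-- The map `gl₅ → H`, `E_{ij} ↦ q i * p j`, i.e. a matrix acts as a linear vector field. -/
def glToH : Matrix Idx Idx ℂ →ₗ[ℂ] H where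
  toFun M := ∑ i, ∑ j, M i j • (q i * p j)
  map_add' M N := by
    simp only [Matrix.add_apply, add_smul, Finset.sum_add_distrib]
  map_smul' c M := by
    simp only [Matrix.smul_apply, smul_assoc, Finset.smul_sum, RingHom.id_apply]

/-- The matrix of `Y^♯ = -(4/3) ∑ xᵢ ∂ᵢ + ∑ zₐ ∂ₐ`. -/
def Ysharp : Matrix Idx Idx ℂ := Matrix.fromBlocks ((-4 / 3 : ℂ) • 1) 0 0 1

/-- The action of `L₀` on the modules `V_X`, as a map with values in linear vector fields. The
degree zero part of `(X, A, ω) ∈ L₀` is the linear part `∑ aᵢⱼ xᵢ ∂ⱼ` of `X` together with `A(0)`,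
and in `𝔤₀ = sl₃ ⊕ sl₂ ⊕ ℂ Y`, where `Y = (2/3) ∑ xᵢ ∂ᵢ ∈ W₃`, it is
`(a - (tr a / 3) 1) + A(0) + (tr a / 2) Y`. Here `sl₃` acts by `xᵢ ∂ⱼ`, `sl₂` acts by `zₐ ∂_b` and
`Y` acts by `Y^♯`. All of `L₊` acts by zero. -/
def actMat (x : EvAmb) : Matrix Idx Idx ℂ :=
  Matrix.fromBlocks (lin x.1 - ((lin x.1).trace / 3) • 1) 0 0 (x.2.1.map ev0)
    + ((lin x.1).trace / 2) • Ysharp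

/-! ### Helper facts: the action of `L₀` on `V_X` respects the brackets -/

theorem hrel (v w : W) : ιH v * ιH w - ιH w * ιH v = algebraMap ℂ H (symp v w) := by
  have h := RingQuot.mkAlgHom_rel ℂ (HRel.comm v w)
  rw [map_sub, map_mul, map_mul, AlgHom.commutes] at h
  exact h

theorem q_q (i j : Idx) : q i * q j = q j * q i := by
  have h := hrel (wq i) (wq j)
  have h0 : symp (wq i) (wq j) = 0 := by simp [symp, wq]
  rw [h0, map_zero, sub_eq_zero] at h
  exact h

theorem p_p (i j : Idx) : p i * p j = p j * p i := by
  have h := hrel (wp i) (wp j)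
  have h0 : symp (wp i) (wp j) = 0 := by simp [symp, wp]
  rw [h0, map_zero, sub_eq_zero] at h
  exact h

theorem p_q (i j : Idx) : p i * q j = q j * p i + (if i = j then 1 else 0) := by
  have h := hrel (wp i) (wq j)
  have h0 : symp (wp i) (wq j) = if i = j then 1 else 0 := by
    simp [symp, wp, wq, Pi.single_apply, eq_comm]
  rw [h0] at h
  have h1 : algebraMap ℂ H (if i = j then 1 else 0) = if i = j then 1 else 0 := by
    split_ifs <;> simp
  rw [h1] at h
  exact sub_eq_iff_eq_add'.mp h

theorem glToH_mul (M N : Matrix Idx Idx ℂ) :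
    glToH (M * N - N * M) = glToH M * glToH N - glToH N * glToH M := by
  have key : ∀ i j k l : Idx, (q i * p j) * (q k * p l) - (q k * p l) * (q i * p j)
      = (if j = k then (1 : ℂ) else 0) • (q i * p l) - (if l = i then (1 : ℂ) else 0) • (q k * p j) := by
    intro i j k l
    have e1 : (q i * p j) * (q k * p l) = q i * (p j * q k) * p l := by noncomm_ring
    have e2 : (q k * p l) * (q i * p j) = q k * (p l * q i) * p j := by noncomm_ring
    have e3 : q i * (q k * p j) * p l = q k * (q i * p l) * p j := by
      calc q i * (q k * p j) * p l = (q i * q k) * (p j * p l) := by noncomm_ring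
        _ = (q k * q i) * (p l * p j) := by rw [q_q i k, p_p j l]
        _ = q k * (q i * p l) * p j := by noncomm_ring
    rw [e1, e2, p_q, p_q, mul_add, add_mul, mul_add, add_mul, e3]
    split_ifs <;> simp
  have hM : ∀ M : Matrix Idx Idx ℂ, glToH M = ∑ s : Idx × Idx, M s.1 s.2 • (q s.1 * p s.2) := by
    intro M
    rw [Fintype.sum_prod_type]; rfl
  have prod : ∀ M N : Matrix Idx Idx ℂ, glToH M * glToH N
      = ∑ s : Idx × Idx, ∑ t : Idx × Idx,
        (M s.1 s.2 * N t.1 t.2) • ((q s.1 * p s.2) * (q t.1 * p t.2)) := by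
    intro M N
    simp only [hM, Finset.sum_mul_sum, smul_mul_smul_comm]
  have prod' : glToH N * glToH M
      = ∑ s : Idx × Idx, ∑ t : Idx × Idx,
        (M s.1 s.2 * N t.1 t.2) • ((q t.1 * p t.2) * (q s.1 * p s.2)) := by
    rw [prod, Finset.sum_comm]
    simp only [mul_comm]
  rw [prod, prod', ← Finset.sum_sub_distrib]
  simp only [← Finset.sum_sub_distrib, ← smul_sub, key]
  simp only [smul_sub, smul_smul, Finset.sum_sub_distrib, Fintype.sum_prod_type, map_sub]
  congr 1
  · simp only [mul_ite, mul_one, mul_zero, ite_smul, zero_smul, Finset.sum_ite_eq,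
      Finset.sum_ite_irrel, Finset.sum_const_zero, Finset.mem_univ, if_true]
    change ∑ i, ∑ j, (M * N) i j • (q i * p j) = _
    simp only [Matrix.mul_apply, Finset.sum_smul]
    refine Finset.sum_congr rfl fun i _ => ?_
    rw [Finset.sum_comm]
  · simp only [mul_ite, mul_one, mul_zero, ite_smul, zero_smul, Finset.sum_ite_eq',
      Finset.sum_ite_irrel, Finset.sum_const_zero, Finset.mem_univ, if_true]
    change ∑ i, ∑ j, (N * M) i j • (q i * p j) = _
    simp only [Matrix.mul_apply, Finset.sum_smul]
    symm
    calc ∑ k, ∑ j, ∑ i, (M k j * N i k) • (q i * p j)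
        = ∑ k, ∑ i, ∑ j, (M k j * N i k) • (q i * p j) :=
          Finset.sum_congr rfl fun k _ => Finset.sum_comm
      _ = ∑ i, ∑ k, ∑ j, (M k j * N i k) • (q i * p j) := Finset.sum_comm
      _ = ∑ i, ∑ j, ∑ k, (M k j * N i k) • (q i * p j) :=
          Finset.sum_congr rfl fun i _ => Finset.sum_comm
      _ = _ := by simp only [mul_comm]

theorem lin_vbr (X Y : Tri) (hX : ∀ i, ev0 (X i) = 0) (hY : ∀ i, ev0 (Y i) = 0) :
    lin (vbr X Y) = lin X * lin Y - lin Y * lin X := by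
  ext i j
  simp only [lin, vbr, ap, pd_add, pd_sub, pd_mul, map_add, map_sub, map_mul, hX, hY, zero_mul,
    zero_add, Matrix.of_apply, Matrix.sub_apply, Matrix.mul_apply, Fin.sum_univ_three]

theorem actMat_eeFun (x y : EvAmb) (hx : ∀ i, ev0 (x.1 i) = 0) (hy : ∀ i, ev0 (y.1 i) = 0) :
    actMat (eeFun x y) = actMat x * actMat y - actMat y * actMat x := by
  have h1 := lin_vbr x.1 y.1 hx hy
  have ht : (lin (vbr x.1 y.1)).trace = 0 := by
    rw [h1, Matrix.trace_sub, Matrix.trace_mul_comm, sub_self]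
  have hA : (eeFun x y).2.1.map ev0
      = x.2.1.map ev0 * y.2.1.map ev0 - y.2.1.map ev0 * x.2.1.map ev0 := by
    ext i j
    simp only [eeFun, ap, Matrix.map_apply, Matrix.of_apply, Matrix.sub_apply, Matrix.mul_apply,
      Fin.sum_univ_two, map_add, map_sub, map_mul, hx, hy]
    ring
  have hb : ∀ z : EvAmb, actMat z = Matrix.fromBlocks (lin z.1 - (lin z.1).trace • 1) 0 0
      (z.2.1.map ev0 + ((lin z.1).trace / 2) • 1) := by
    intro z
    simp only [actMat, Ysharp, Matrix.fromBlocks_smul, Matrix.fromBlocks_add, smul_zero, add_zero,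
      smul_smul]
    congr 1
    rw [sub_add, ← sub_smul]
    congr 2
    ring
  have h2 : (eeFun x y).1 = vbr x.1 y.1 := rfl
  rw [hb, h2, ht, hA, h1, hb x, hb y]
  simp only [Matrix.fromBlocks_multiply]
  rw [sub_eq_add_neg (Matrix.fromBlocks _ _ _ _), Matrix.fromBlocks_neg, Matrix.fromBlocks_add]
  congr 1 <;> simp [sub_mul, mul_sub, add_mul, mul_add] <;> module

theorem lin_add (X Y : Tri) : lin (X + Y) = lin X + lin Y := by
  ext i j
  simp only [lin, Matrix.of_apply, Matrix.add_apply, Pi.add_apply, pd_add, map_add]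

theorem lin_smul (c : ℂ) (X : Tri) : lin (c • X) = c • lin X := by
  ext i j
  simp only [lin, Matrix.of_apply, Matrix.smul_apply, Pi.smul_apply, smul_C, pd_mul, pd_C, map_add,
    map_mul, ev0_C, smul_eq_mul, zero_mul, add_zero]

theorem actMat_add (x y : EvAmb) : actMat (x + y) = actMat x + actMat y := by
  have h : (x + y).2.1.map ev0 = x.2.1.map ev0 + y.2.1.map ev0 := by
    ext i j; exact map_add ev0 (x.2.1 i j) (y.2.1 i j)
  have e : lin x.1 + lin y.1 - (((lin x.1).trace + (lin y.1).trace) / 3) • (1 : Matrix _ _ ℂ)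
      = (lin x.1 - ((lin x.1).trace / 3) • 1) + (lin y.1 - ((lin y.1).trace / 3) • 1) := by
    module
  have h' : (Matrix.fromBlocks (lin x.1 + lin y.1 - ((lin x.1 + lin y.1).trace / 3) • 1) 0 0
        (x.2.1.map ev0 + y.2.1.map ev0) : Matrix Idx Idx ℂ)
      = Matrix.fromBlocks (lin x.1 - ((lin x.1).trace / 3) • 1) 0 0 (x.2.1.map ev0)
        + Matrix.fromBlocks (lin y.1 - ((lin y.1).trace / 3) • 1) 0 0 (y.2.1.map ev0) := by
    rw [Matrix.fromBlocks_add, Matrix.trace_add, add_zero, add_zero, e]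
  rw [actMat, h, Prod.fst_add, lin_add, h', actMat, actMat, Matrix.trace_add]
  module

theorem actMat_smul (c : ℂ) (x : EvAmb) : actMat (c • x) = c • actMat x := by
  have h : (c • x).2.1.map ev0 = c • x.2.1.map ev0 := by
    ext i j
    change ev0 (c • x.2.1 i j) = c * ev0 (x.2.1 i j)
    rw [smul_C, map_mul, ev0_C]
  have e : c • lin x.1 - ((c * (lin x.1).trace) / 3) • (1 : Matrix _ _ ℂ)
      = c • (lin x.1 - ((lin x.1).trace / 3) • 1) := by
    module
  rw [actMat, h, Prod.smul_fst, lin_smul, actMat, smul_add, Matrix.fromBlocks_smul,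
    Matrix.trace_smul, smul_zero, smul_zero, smul_eq_mul, e, smul_smul, mul_div_assoc]

theorem actMat_ooFun {a b : Od} (ha : a ∈ L0.odd) (hb : b ∈ L0.odd) : actMat (ooFun a b) = 0 := by
  obtain ⟨g, σ⟩ := a
  obtain ⟨h, τ⟩ := b
  have g0 : ∀ i, ev0 (g i) = 0 := fun i => (ha i).1
  have g1 : ∀ i j, ev0 (pd j (g i)) = 0 := fun i => (ha i).2
  have g2 : ∀ i j, ev0 (d0 (g i) j) = 0 := by
    intro i j; fin_cases j <;> exact g1 _ _
  have h0 : ∀ i, ev0 (h i) = 0 := fun i => (hb i).1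
  have h1 : ∀ i j, ev0 (pd j (h i)) = 0 := fun i => (hb i).2
  have h2 : ∀ i j, ev0 (d0 (h i) j) = 0 := by
    intro i j; fin_cases j <;> exact h1 _ _
  have hl : lin (ooFun (g, σ) (h, τ)).1 = 0 := by
    ext i j
    simp only [lin, ooFun, Fin.sum_univ_two, Matrix.of_apply, Matrix.zero_apply, w11_app,
      Pi.add_apply, Pi.sub_apply, Pi.neg_apply, Pi.smul_apply, smul_eq_mul, pd_add, pd_sub, pd_neg,
      pd_mul, map_add, map_sub, map_mul, map_neg, g0, g1, g2, h0, h1, h2, mul_zero, zero_mul,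
      add_zero, sub_zero, neg_zero]
  have hA : (ooFun (g, σ) (h, τ)).2.1.map ev0 = 0 := by
    ext i j
    simp only [ooFun, Fin.sum_univ_two, Matrix.of_apply, Matrix.zero_apply, Matrix.map_apply, w12,
      map_add, map_sub, map_mul, map_neg, g0, g2, h0, h2, mul_zero, zero_mul,
      add_zero, sub_zero, neg_zero]
  rw [actMat, hl, hA]
  simp

/-! ### The induced modules -/

/-- `V_X` as an `L₀`-module, with the action of `𝔤₀` modified by `Y ↦ Y^♯`. -/
def modX (X : Ty) : L0.EvenModule (VX X) where
  ρ :=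
    { toFun := fun x => Algebra.lsmul ℂ ℂ (VX X) (glToH (actMat (x : Ev)))
      map_add' := fun x y => by
        change Algebra.lsmul ℂ ℂ (VX X) (glToH (actMat ((x : Ev) + (y : Ev) : EvAmb))) = _
        rw [actMat_add, map_add, map_add]
      map_smul' := fun c x => by
        change Algebra.lsmul ℂ ℂ (VX X) (glToH (actMat (c • (x : Ev) : EvAmb))) = _
        rw [actMat_smul, map_smul, map_smul]; rfl }
  ρ_ee x y := by
    change Algebra.lsmul ℂ ℂ (VX X) (glToH (actMat (eeFun (x : Ev) (y : Ev)))) =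
      Algebra.lsmul ℂ ℂ (VX X) (glToH (actMat (x : Ev))) *
        Algebra.lsmul ℂ ℂ (VX X) (glToH (actMat (y : Ev))) -
      Algebra.lsmul ℂ ℂ (VX X) (glToH (actMat (y : Ev))) *
        Algebra.lsmul ℂ ℂ (VX X) (glToH (actMat (x : Ev)))
    rw [actMat_eeFun _ _ x.2 y.2, glToH_mul, map_sub, map_mul, map_mul]
  ρ_oo a b := by
    change Algebra.lsmul ℂ ℂ (VX X) (glToH (actMat (ooFun (a : Od) (b : Od)))) = 0
    rw [actMat_ooFun a.2 b.2, map_zero, map_zero]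

/-- The induced `E(3,8)`-module `M(V_X) = U(L) ⊗_{U(L₀)} V_X`. -/
abbrev MX (X : Ty) : Type := LieSuperalgebra.Induced (modX X)

/-! ## The element `∇` -/

/-- The element `dᵢᵃ = xᵢ ⊗ εᵃ` of `E(3,8) ⊆ U(E(3,8))`, where `a = 0, 1` stands for `+, -`. -/
def dd (i : Fin 3) (a : Fin 2) : L.U := L.ι (0, (Pi.single a (MvPowerSeries.X i), 0))

/-- The operators `∂₁, ∂₂, ∂₃, ∂₊, ∂₋` on `V_X`. -/
def pX (X : Ty) (i : Idx) : Module.End ℂ (VX X) := Algebra.lsmul ℂ ℂ (VX X) (p i)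

/-- `Δ^± = ∑ᵢ dᵢ^± ⊗ ∂ᵢ`. -/
def Del (X : Ty) (a : Fin 2) : L.U ⊗[ℂ] Module.End ℂ (VX X) :=
  ∑ i : Fin 3, dd i a ⊗ₜ[ℂ] pX X (.inl i)

/-- `δ_± = 1 ⊗ ∂_±`. -/
def del (X : Ty) (a : Fin 2) : L.U ⊗[ℂ] Module.End ℂ (VX X) := 1 ⊗ₜ[ℂ] pX X (.inr a)

/-- `∇ = Δ⁺ δ₊ + Δ⁻ δ₋`, an element of the algebra `U(L) ⊗ End(V_X)`. -/
def nabla (X : Ty) : L.U ⊗[ℂ] Module.End ℂ (VX X) := Del X 0 * del X 0 + Del X 1 * del X 1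

/-- The linear map `φ : M(V_X) → M(V_X)` is given by the element `Φ = ∑ₘ uₘ ⊗ ℓₘ`, that is,
`φ(u ⊗ v) = ∑ₘ (u uₘ) ⊗ ℓₘ(v)` for all `u ∈ U(L)` and `v ∈ V_X`. -/
def GivenBy {X : Ty} (Φ : L.U ⊗[ℂ] Module.End ℂ (VX X)) (φ : MX X →ₗ[L.U] MX X) : Prop :=
  ∀ (u : L.U) (v : VX X), φ (LieSuperalgebra.Induced.mk (modX X) (u ⊗ₜ[ℂ] v)) =
    LieSuperalgebra.Induced.mk (modX X) (LieSuperalgebra.insertInto Φ u v)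

end E38
end

/-! A morphism out of an induced module is the same as a linear map `k` from `V_X` to the target
that commutes with the even part of `L₀` and whose image is killed by the odd part of `L₀`
(`Induced.lift`). For `φ` the map is `k v = ∑ dᵢᵃ ⊗ ∂ᵢ ∂ₐ v` (`nablaVec`), so (a) amounts to two
conditions on `k`. Both come down to computations in the Heisenberg algebra `H`, which is why the
four types of modules need no separate treatment.

Even condition. Modulo the odd part of `L₀`, which annihilates `1 ⊗ V_X`, an even element `x` acts
on the span of the `dᵢᵃ` through the linear part of its vector field, half its trace, and the value
of its matrix at the origin (`sub_dd_mem`). The products `∂ᵢ ∂ₐ` transform under commutation with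
linear vector fields in the dual way (`glToH_mul_p_p`), so the contraction `∑ dᵢᵃ ⊗ ∂ᵢ ∂ₐ` is
invariant under `sl₃ ⊕ sl₂`. Invariance under `Y` depends on `Y^♯`: `Y` has weight 2/3 - 1 = -1/3 on
`dᵢᵃ`, and `[∂ᵢ ∂ₐ, Y^♯] = (-4/3 + 1) ∂ᵢ ∂ₐ`.

Odd condition. An odd `a` in `L₀` kills `1 ⊗ V_X`, and `[a, dᵢᵇ]` lies in `L₀`. Hence `a · k v = 1 ⊗
∑ [a, dᵢᵇ] ∂ᵢ ∂_b v`, and the sum already vanishes in `H` (`sum_glToH_ooFun`).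

For (b), the operators `∂ᵢ ∂ₐ` commute, so `2∇²` is the sum of `[dᵢᵃ, dⱼᵇ] ⊗ ∂ᵢ ∂ₐ ∂ⱼ ∂_b`. The
bracket is a multiple of `dxᵢ ∧ dxⱼ`, antisymmetric in `i, j`, while the operator is symmetric in
them; the sum is zero (`nabla_mul_nabla`). The same commutativity identifies `φ ∘ φ` with the map
given by `∇²`. -/

noncomputable section

/-! ### Relations in `U(L)` and the universal property of induced modules -/

namespace LieSuperalgebra

variable {L₀ L₁ : Type*} [AddCommGroup L₀] [Module ℂ L₀] [AddCommGroup L₁] [Module ℂ L₁]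

theorem ι_even_mul_odd (L : LieSuperalgebra L₀ L₁) (x : L₀) (a : L₁) :
    L.ι (x, 0) * L.ι (0, a) = L.ι (0, a) * L.ι (x, 0) + L.ι (0, L.eo x a) := by
  have h := RingQuot.mkAlgHom_rel ℂ (EnvRel.eo (L := L) x a)
  rw [map_sub, map_mul, map_mul] at h
  exact sub_eq_iff_eq_add'.mp h

theorem ι_odd_mul_odd (L : LieSuperalgebra L₀ L₁) (a b : L₁) :
    L.ι (0, a) * L.ι (0, b) + L.ι (0, b) * L.ι (0, a) = L.ι (L.oo a b, 0) := by
  have h := RingQuot.mkAlgHom_rel ℂ (EnvRel.oo (L := L) a b)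
  rw [map_add, map_mul, map_mul] at h
  exact h

variable {L : LieSuperalgebra L₀ L₁} {P : L.Sub} {V : Type*} [AddCommGroup V] [Module ℂ V]

/-- The generators of `inducedRel` are the case `u = 1`; since it is a left `U(L)`-submodule,
multiplying by `u` gives the balanced relation in general. -/
theorem Induced.mk_even (M : P.EvenModule V) (u : L.U) (x : P.even) (v : V) :
    Induced.mk M ((u * L.ι ((x : L₀), 0)) ⊗ₜ[ℂ] v) = Induced.mk M (u ⊗ₜ[ℂ] M.ρ x v) := by
  have h : L.ι ((x : L₀), 0) ⊗ₜ[ℂ] v - 1 ⊗ₜ[ℂ] (M.ρ x v) ∈ inducedRel M :=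
    Submodule.subset_span (Or.inl ⟨x, v, rfl⟩)
  have h' := (inducedRel M).smul_mem u h
  rw [smul_sub, TensorProduct.smul_tmul', TensorProduct.smul_tmul', smul_eq_mul, smul_eq_mul,
    mul_one] at h'
  exact (Submodule.Quotient.eq _).mpr h'

theorem Induced.mk_odd (M : P.EvenModule V) (u : L.U) (a : P.odd) (v : V) :
    Induced.mk M ((u * L.ι (0, (a : L₁))) ⊗ₜ[ℂ] v) = 0 := by
  have h : L.ι (0, (a : L₁)) ⊗ₜ[ℂ] v ∈ inducedRel M :=
    Submodule.subset_span (Or.inr ⟨a, v, rfl⟩)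
  have h' := (inducedRel M).smul_mem u h
  rw [TensorProduct.smul_tmul', smul_eq_mul] at h'
  exact (Submodule.Quotient.mk_eq_zero _).mpr h'

/-- The linear map `a ↦ a ⊗ v` on the odd part of `L`. -/
def Induced.oddTmul (M : P.EvenModule V) (v : V) : L₁ →ₗ[ℂ] Induced M :=
  (Induced.mk M).restrictScalars ℂ ∘ₗ (TensorProduct.mk ℂ L.U V).flip v ∘ₗ L.ι ∘ₗ
    LinearMap.inr ℂ L₀ L₁

theorem Induced.oddTmul_apply (M : P.EvenModule V) (v : V) (a : L₁) :
    Induced.oddTmul M v a = Induced.mk M (L.ι (0, a) ⊗ₜ[ℂ] v) := rfl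

theorem Induced.oddTmul_eq_zero (M : P.EvenModule V) (v : V) {a : L₁} (ha : a ∈ P.odd) :
    Induced.oddTmul M v a = 0 := by
  simpa only [one_mul, Induced.oddTmul_apply] using Induced.mk_odd M 1 ⟨a, ha⟩ v

/-- In `U(L)` one has `x a = a x + [x, a]`, and the `x` now on the right crosses the tensor sign and
acts on `v`. -/
theorem Induced.even_smul_oddTmul (M : P.EvenModule V) (x : P.even) (a : L₁) (v : V) :
    L.ι ((x : L₀), 0) • Induced.oddTmul M v a
      = Induced.oddTmul M (M.ρ x v) a + Induced.oddTmul M v (L.eo x a) := by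
  simp only [Induced.oddTmul_apply]
  rw [← map_smul, TensorProduct.smul_tmul', smul_eq_mul, ι_even_mul_odd, TensorProduct.add_tmul,
    map_add, Induced.mk_even]

/-- The universal property of the induced module. -/
def Induced.lift (M : P.EvenModule V) {N : Type*} [AddCommGroup N] [Module ℂ N] [Module L.U N]
    [IsScalarTower ℂ L.U N] (k : V →ₗ[ℂ] N)
    (he : ∀ (x : P.even) (v : V), L.ι ((x : L₀), 0) • k v = k (M.ρ x v))
    (ho : ∀ (a : P.odd) (v : V), L.ι (0, (a : L₁)) • k v = 0) : Induced M →ₗ[L.U] N :=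
  (inducedRel M).liftQ
    (TensorProduct.AlgebraTensorModule.lift (LinearMap.toSpanSingleton L.U (V →ₗ[ℂ] N) k)) (by
      -- It suffices that `u ⊗ v ↦ u • k v` kills the generators, and on the two families of
      -- generators this is `he` and `ho`.
      rw [inducedRel, Submodule.span_le]
      rintro t (⟨x, v, rfl⟩ | ⟨a, v, rfl⟩)
      · simp [he]
      · simp [ho])

theorem Induced.lift_mk (M : P.EvenModule V) {N : Type*} [AddCommGroup N] [Module ℂ N]
    [Module L.U N] [IsScalarTower ℂ L.U N] (k : V →ₗ[ℂ] N)
    (he : ∀ (x : P.even) (v : V), L.ι ((x : L₀), 0) • k v = k (M.ρ x v))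
    (ho : ∀ (a : P.odd) (v : V), L.ι (0, (a : L₁)) • k v = 0) (u : L.U) (v : V) :
    Induced.lift M k he ho (Induced.mk M (u ⊗ₜ[ℂ] v)) = u • k v := by
  change (inducedRel M).liftQ _ _ ((inducedRel M).mkQ _) = _
  rw [Submodule.mkQ_apply, Submodule.liftQ_apply]
  simp

theorem Induced.hom_ext (M : P.EvenModule V) {N : Type*} [AddCommGroup N] [Module L.U N]
    {φ ψ : Induced M →ₗ[L.U] N}
    (h : ∀ (u : L.U) (v : V), φ (Induced.mk M (u ⊗ₜ[ℂ] v)) = ψ (Induced.mk M (u ⊗ₜ[ℂ] v))) :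
    φ = ψ := by
  refine LinearMap.ext fun m => ?_
  obtain ⟨t, rfl⟩ := Submodule.mkQ_surjective _ m
  induction t with
  | zero => rw [map_zero, map_zero, map_zero]
  | tmul u v => exact h u v
  | add s t hs ht => rw [map_add, map_add, map_add, hs, ht]

theorem insertInto_tmul (u w : L.U) (l : Module.End ℂ V) (v : V) :
    insertInto (w ⊗ₜ[ℂ] l) u v = (u * w) ⊗ₜ[ℂ] l v := rfl

theorem insertInto_sum {I : Type*} (s : Finset I) (Φ : I → L.U ⊗[ℂ] Module.End ℂ V) (u : L.U)
    (v : V) : insertInto (∑ i ∈ s, Φ i) u v = ∑ i ∈ s, insertInto (Φ i) u v :=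
  map_sum (TensorProduct.map (LinearMap.mulLeft ℂ u) (LinearMap.applyₗ v)) Φ s

theorem insertInto_zero (u : L.U) (v : V) :
    insertInto (0 : L.U ⊗[ℂ] Module.End ℂ V) u v = 0 :=
  map_zero (TensorProduct.map (LinearMap.mulLeft ℂ u) (LinearMap.applyₗ v))

end LieSuperalgebra

/-! ### Brackets of the elements `dᵢᵃ` with `L₀` and with each other -/

namespace E38

open LieSuperalgebra

/-- The element `xᵢ ⊗ εᵃ` of the odd part of `E(3,8)`. -/
def ddOd (i : Fin 3) (a : Fin 2) : Od := (Pi.single a (MvPowerSeries.X i), 0)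

theorem pd_X (i j : Fin 3) : pd i (MvPowerSeries.X j) = if i = j then 1 else 0 := by
  rw [pd, MvPowerSeries.pderiv_X, Pi.single_apply]
  simp only [eq_comm]

theorem ev0_X (i : Fin 3) : ev0 (MvPowerSeries.X i) = 0 := MvPowerSeries.constantCoeff_X i

theorem ev0_hf : ev0 hf = 1 / 2 := ev0_C _

/-- Membership in `L0.odd` constrains only the 1-jet at the origin of the function component; the
2-form terms of the bracket play no role. As `X(0) = 0`, that 1-jet is linear: `X(xᵢ)` contributes
column `i` of `lin X`, the twist `-½ div X` contributes the trace term, and `A` contributes its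
value at the origin. -/
theorem sub_dd_mem (x : Ev) (hx : x ∈ L0.even) (i : Fin 3) (a : Fin 2) :
    L.eo x (ddOd i a) - (∑ j, lin x.1.1 j i • ddOd j a - (1 / 2 * (lin x.1.1).trace) • ddOd i a
      + ∑ b, ev0 (x.1.2.1 b a) • ddOd i b) ∈ L0.odd := by
  obtain ⟨⟨X, A, ω⟩, hm⟩ := x
  have h0 : ∀ i, ev0 (X i) = 0 := hx
  change eoFun (X, A, ω) (ddOd i a) - (∑ j, lin X j i • ddOd j a
    - (1 / 2 * (lin X).trace) • ddOd i a + ∑ b, ev0 (A b a) • ddOd i b) ∈ L0.odd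
  intro c
  constructor
  · fin_cases a <;> fin_cases c <;>
      simp [eoFun, ddOd, ap, Fin.sum_univ_three, smul_C, h0, ev0_X]
  · intro k
    fin_cases a <;> fin_cases c <;> fin_cases i <;> fin_cases k <;>
      simp [eoFun, ddOd, ap, Fin.sum_univ_three, smul_C, h0, ev0_X, pd_add, pd_sub, pd_mul, pd_X,
        lin, Matrix.trace, ev0_hf, ev0_C, pd_C, dv, pd_hf, pd_zero]

/-- The vector field of the bracket combines `dg ∧ dxᵢ` and `xᵢ σ`, and both vanish at the origin
because `dg(0) = 0` and `xᵢ(0) = 0`. -/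
theorem ooFun_ddOd_mem (a : Od) (ha : a ∈ L0.odd) (i : Fin 3) (b : Fin 2) :
    L.oo a (ddOd i b) ∈ L0.even := by
  obtain ⟨g, σ⟩ := a
  have h0 : ∀ i, ev0 (g i) = 0 := fun i => (ha i).1
  have h1 : ∀ i j, ev0 (pd j (g i)) = 0 := fun i => (ha i).2
  intro k
  change ev0 ((ooFun (g, σ) (ddOd i b)).1 k) = 0
  have h4 : ∀ i j, ev0 (d0 (g i) j) = 0 := by
    intro i j; fin_cases j <;> exact h1 _ _
  fin_cases b <;> simp [ooFun, ddOd, w11_app, h4, ev0_X]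

/-- With no 2-form components, the only surviving term is `-(εᵃ ∧ εᵇ) dxᵢ ∧ dxⱼ`, which is
antisymmetric in `i, j` for fixed `a, b`. -/
theorem ooFun_ddOd_swap (i j : Fin 3) (a b : Fin 2) :
    ooFun (ddOd i a) (ddOd j b) = - ooFun (ddOd j a) (ddOd i b) := by
  have hs := w11_swap (d0 (MvPowerSeries.X i)) (d0 (MvPowerSeries.X j))
  have h0 : dv 0 = 0 := by simp [dv, pd_zero]
  have h1 : ∀ f, w11 f 0 = 0 := fun f => by simp [w11]
  have h1' : ∀ f, w11 0 f = 0 := fun f => by simp [w11]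
  have h2 : ∀ f, w12 f 0 = 0 := fun f => by simp [w12]
  have h3 : d1 0 = 0 := by simp [d1, pd_zero]
  refine Prod.ext ?_ (Prod.ext ?_ ?_)
  · fin_cases a <;> fin_cases b <;> simp [ooFun, ddOd, d0_zero, ww, hs, h1, h1']
  · ext p q
    simp [ooFun, ddOd, h0, h2]
  · simp [ooFun, ddOd, h0, h1, h3, con, d0_zero]

theorem L_oo_ddOd_swap (i j : Fin 3) (a b : Fin 2) :
    L.oo (ddOd i a) (ddOd j b) = - L.oo (ddOd j a) (ddOd i b) :=
  Subtype.ext (ooFun_ddOd_swap i j a b)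

/-! ### Computations in the Heisenberg algebra -/

theorem glToH_fromBlocks (M : Matrix (Fin 3) (Fin 3) ℂ) (N : Matrix (Fin 2) (Fin 2) ℂ) :
    glToH (Matrix.fromBlocks M 0 0 N) = ∑ i, ∑ j, M i j • (q (.inl i) * p (.inl j))
      + ∑ a, ∑ b, N a b • (q (.inr a) * p (.inr b)) := by
  change ∑ i, ∑ j, Matrix.fromBlocks M 0 0 N i j • (q i * p j) = _
  simp [Fintype.sum_sum_type]

/-- Collects the scalar parts: on the `xᵢ` block the trace has coefficient -1/3 - (1/2)(4/3) = -1,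
on the `zₐ` block 1/2. -/
theorem actMat_eq (x : EvAmb) : actMat x = Matrix.fromBlocks (lin x.1 - (lin x.1).trace • 1) 0 0
    (x.2.1.map ev0 + ((lin x.1).trace / 2) • 1) := by
  simp only [actMat, Ysharp, Matrix.fromBlocks_smul, Matrix.fromBlocks_add, smul_zero, add_zero,
    smul_smul]
  congr 1
  rw [sub_add, ← sub_smul]
  congr 2
  ring

/-- For `a = (g, σ)` the vector field of the bracket is the sum over `c` of `(εᶜ ∧ εᵇ)(xᵢ σ_c - dg_c
∧ dxᵢ)`. The indices `j + 1`, `j + 2` are cyclic and come from the components of the wedge product.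
-/
theorem lin_ooFun_ddOd (a : Od) (ha : a ∈ L0.odd) (i k j : Fin 3) (b : Fin 2) :
    lin (ooFun a (ddOd i b)).1 k j = ∑ c, ev0 (ww c b) *
      ((if j + 1 = i then ev0 (pd k (pd (j + 2) (a.1 c))) else 0)
        - (if j + 2 = i then ev0 (pd k (pd (j + 1) (a.1 c))) else 0)
        + (if k = i then ev0 (a.2 c j) else 0)) := by
  obtain ⟨g, σ⟩ := a
  have h1 : ∀ i j, ev0 (pd j (g i)) = 0 := fun i => (ha i).2
  have h2 (l k : Fin 3) (f : Fn) : ev0 (pd k (f * pd l (MvPowerSeries.X i)))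
      = if l = i then ev0 (pd k f) else 0 := by
    rw [pd_X]
    split_ifs
    · rw [mul_one]
    · rw [mul_zero, pd_zero, map_zero]
  have h3 (k : Fin 3) (f : Fn) : ev0 (pd k (MvPowerSeries.X i * f))
      = if k = i then ev0 f else 0 := by
    rw [pd_mul, pd_X, map_add, map_mul, ev0_X, zero_mul, zero_add]
    split_ifs
    · rw [one_mul]
    · rw [zero_mul, map_zero]
  fin_cases b <;> fin_cases j <;>
    -- The Leibniz rule is disabled so that derivatives of products stay in the shape to which `h2`
    -- and `h3` apply.
    simp [-Derivation.leibniz, ooFun, ddOd, lin, w11_0, w11_1, w11_2, d0_0, d0_1, d0_2, Fin.sum_univ_two, ww, pd_add,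
      pd_sub, pd_neg, h2, h3, pd_zero] <;> ring

/-- At the origin `dxᵢ ∧ σ - xᵢ dσ` reduces to the coefficient `σᵢ(0)`. -/
theorem ev0_ooFun_ddOd (a : Od) (i : Fin 3) (b c d : Fin 2) :
    ev0 ((ooFun a (ddOd i b)).2.1 c d) = - ∑ e, ev0 (sy e b c d) * ev0 (a.2 e i) := by
  obtain ⟨g, σ⟩ := a
  have h1 : ∀ f, w12 f 0 = 0 := fun f => by simp [w12]
  have h0 : dv 0 = 0 := by simp [dv, pd_zero]
  have h2 (τ : Tri) : w12 (d0 (MvPowerSeries.X i)) τ = τ i := by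
    fin_cases i <;> simp [w12, d0, pd_X]
  have h3 : d0 0 = 0 := d0_zero
  have h4 (τ : Tri) : w12 0 τ = 0 := w12_zero_left τ
  fin_cases b <;> simp [ooFun, ddOd, h0, h1, h2, h3, h4, ev0_X] <;> ring

theorem p_mul_left_comm (i j : Idx) (h : H) : p i * (p j * h) = p j * (p i * h) := by
  rw [← mul_assoc, p_p, mul_assoc]

set_option maxHeartbeats 4000000 in
-- The second derivatives of `g` enter with a trace that vanishes by symmetry, and as coefficients
-- of `x_k ∂ⱼ ∂ᵢ ∂_b` antisymmetric in `i, j`, so they cancel. For the values `σ(0)`, the terms `xᵢ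
-- ∂ⱼ ∂ᵢ ∂_b` cancel against the trace term `-∑ x_k ∂_k`. The trace term `½ ∑ zₐ ∂ₐ` cancels against
-- one half of the symmetric product `v · w` from the `sl₂` component; the other half pairs the
-- antisymmetric form on `ℂ²` with `∂_d ∂_b` and vanishes.
theorem sum_glToH_ooFun (a : Od) (ha : a ∈ L0.odd) :
    ∑ i, ∑ b, glToH (actMat (ooFun a (ddOd i b))) * (p (.inl i) * p (.inr b)) = 0 := by
  simp only [actMat_eq, glToH_fromBlocks, Matrix.trace, Matrix.diag, Matrix.add_apply,
    Matrix.sub_apply, Matrix.smul_apply, Matrix.map_apply, lin_ooFun_ddOd a ha, ev0_ooFun_ddOd,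
    Fin.sum_univ_three, Fin.sum_univ_two, Matrix.one_apply]
  have e00 : ev0 (ww 0 0) = 0 := by simp [ww]
  have e01 : ev0 (ww 0 1) = 1 := by simp [ww]
  have e10 : ev0 (ww 1 0) = -1 := by simp [ww]
  have e11 : ev0 (ww 1 1) = 0 := by simp [ww]
  -- The rules `c0`–`c3` and `d0`–`d3` sort right-nested products of the `∂`'s into a fixed order,
  -- so that equal monomials become identical atoms for `module`.
  have c0 : p (.inl 1) * p (.inl 0) = p (.inl 0) * p (.inl 1) := p_p _ _
  have c1 : p (.inl 2) * p (.inl 0) = p (.inl 0) * p (.inl 2) := p_p _ _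
  have c2 : p (.inl 2) * p (.inl 1) = p (.inl 1) * p (.inl 2) := p_p _ _
  have c3 : p (.inr 1) * p (.inr 0) = p (.inr 0) * p (.inr 1) := p_p _ _
  have d0 (h) : p (.inl 1) * (p (.inl 0) * h) = p (.inl 0) * (p (.inl 1) * h) :=
    p_mul_left_comm _ _ _
  have d1 (h) : p (.inl 2) * (p (.inl 0) * h) = p (.inl 0) * (p (.inl 2) * h) :=
    p_mul_left_comm _ _ _
  have d2 (h) : p (.inl 2) * (p (.inl 1) * h) = p (.inl 1) * (p (.inl 2) * h) :=
    p_mul_left_comm _ _ _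
  have d3 (a : Fin 2) (i : Fin 3) (h) :
      p (.inr a) * (p (.inl i) * h) = p (.inl i) * (p (.inr a) * h) :=
    p_mul_left_comm _ _ _
  -- Cyclic index arithmetic, needed to decide the conditions `j + 1 = i` and `j + 2 = i`.
  have m1 : (1 : Fin 3) + 2 = 0 := rfl
  have m2 : (2 : Fin 3) + 2 = 1 := rfl
  have m3 : (2 : Fin 3) + 1 = 0 := rfl
  have m4 : (1 : Fin 3) + 1 = 2 := rfl
  simp only [sy, Matrix.of_apply, map_mul, map_add, ev0_hf, apply_ite ev0, e00, e01, e10, e11,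
    add_mul, smul_mul_assoc, mul_assoc, c0, c1, c2, c3, d0, d1, d2, d3, m1, m2, m3, m4, zero_add,
    Fin.isValue, map_zero, map_one, pd10, pd20, pd21,
    Fin.reduceEq, if_true, if_false, one_ne_zero, zero_ne_one, zero_mul, mul_zero, add_zero,
    sub_zero, zero_sub, smul_eq_mul, mul_one, one_mul]
  module

/-- Commutation with a linear vector field is a derivation of `H` and `[∂ᵢ, x_k ∂_l] = δᵢₖ ∂_l`, so
each of the two factors contributes one correction sum. -/
theorem glToH_mul_p_p (M : Matrix (Fin 3) (Fin 3) ℂ) (N : Matrix (Fin 2) (Fin 2) ℂ) (i : Fin 3)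
    (a : Fin 2) : p (.inl i) * p (.inr a) * glToH (Matrix.fromBlocks M 0 0 N)
      = glToH (Matrix.fromBlocks M 0 0 N) * (p (.inl i) * p (.inr a))
        + ∑ j, M i j • (p (.inl j) * p (.inr a)) + ∑ b, N a b • (p (.inl i) * p (.inr b)) := by
  have key (k l : Idx) : p (.inl i) * p (.inr a) * (q k * p l)
      = q k * p l * (p (.inl i) * p (.inr a))
        + (if .inl i = k then p l * p (.inr a) else 0)
        + (if .inr a = k then p (.inl i) * p l else 0) := by
    have e1 : p (.inl i) * p (.inr a) * (q k * p l) = p (.inl i) * (p (.inr a) * q k) * p l := by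
      noncomm_ring
    have e2 : p (.inl i) * (q k * p (.inr a)) * p l = (p (.inl i) * q k) * (p (.inr a) * p l) := by
      noncomm_ring
    rw [e1, p_q, mul_add, add_mul, e2, p_q, add_mul, p_p (.inr a) l, ← mul_assoc (q k * _),
      mul_assoc (q k), p_p (.inl i) l]
    split_ifs <;> simp [mul_assoc, p_p (.inl i) l]
  rw [glToH_fromBlocks]
  simp only [mul_add, add_mul, Finset.mul_sum, Finset.sum_mul, mul_smul_comm, smul_mul_assoc, key,
    reduceCtorEq, if_false, add_zero, smul_add, Finset.sum_add_distrib, Sum.inl.injEq,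
    Sum.inr.injEq, smul_ite, smul_zero, Finset.sum_ite_irrel, Finset.sum_const_zero,
    Finset.sum_ite_eq, Finset.mem_univ, if_true]
  abel

/-! ### Compatibility of `v ↦ ∑ dᵢᵃ ⊗ ∂ᵢ ∂ₐ v` with `L₀` -/

/-- The map `h ↦ dᵢᵃ ⊗ h v` with values in `M(V_X)`. -/
def ddTmul (X : Ty) (v : VX X) (i : Fin 3) (a : Fin 2) : H →ₗ[ℂ] MX X :=
  (Induced.mk (modX X)).restrictScalars ℂ ∘ₗ TensorProduct.mk ℂ L.U (VX X) (dd i a) ∘ₗ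
    (LinearMap.toSpanSingleton H (VX X) v).restrictScalars ℂ

theorem ddTmul_apply (X : Ty) (v : VX X) (i : Fin 3) (a : Fin 2) (h : H) :
    ddTmul X v i a h = Induced.mk (modX X) (dd i a ⊗ₜ[ℂ] (h • v)) := rfl

theorem oddTmul_ddOd (X : Ty) (v : VX X) (i : Fin 3) (a : Fin 2) (h : H) :
    Induced.oddTmul (modX X) (h • v) (ddOd i a) = ddTmul X v i a h := rfl

theorem rho_apply (X : Ty) (x : L0.even) (v : VX X) :
    (modX X).ρ x v = glToH (actMat (x : Ev)) • v := rfl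

/-- Commuting `x` past `dᵢᵃ` produces `[x, dᵢᵃ]`, which may be replaced by its degree -1 part
because odd elements of `L₀` kill `1 ⊗ V_X`. -/
theorem even_smul_ddTmul (X : Ty) (v : VX X) (x : L0.even) (i : Fin 3) (a : Fin 2) (h : H) :
    L.ι ((x : Ev), 0) • ddTmul X v i a h = ddTmul X v i a (glToH (actMat (x : Ev)) * h)
      + ∑ j, lin x.1.1.1 j i • ddTmul X v j a h
      - (1 / 2 * (lin x.1.1.1).trace) • ddTmul X v i a h
      + ∑ b, ev0 (x.1.1.2.1 b a) • ddTmul X v i b h := by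
  have hm := Induced.oddTmul_eq_zero (modX X) (h • v) (sub_dd_mem x x.2 i a)
  rw [map_sub, sub_eq_zero] at hm
  rw [← oddTmul_ddOd, Induced.even_smul_oddTmul, hm, rho_apply, ← mul_smul, oddTmul_ddOd]
  simp only [map_add, map_sub, map_sum, map_smul, oddTmul_ddOd]
  abel

/-- Write `x d = [x, d] - d x`: the term `d x ⊗ hv` is zero, and `[x, d]` is an even element of
`L₀`, so it crosses the tensor sign. -/
theorem odd_smul_ddTmul (X : Ty) (v : VX X) (x : L0.odd) (i : Fin 3) (a : Fin 2) (h : H) :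
    L.ι (0, (x : Od)) • ddTmul X v i a h
      = Induced.mk (modX X) (1 ⊗ₜ[ℂ] ((glToH (actMat (ooFun x (ddOd i a))) * h) • v)) := by
  have hm := Induced.mk_odd (modX X) (L.ι (0, ddOd i a)) x (h • v)
  have he := Induced.mk_even (modX X) 1 ⟨_, ooFun_ddOd_mem x x.2 i a⟩ (h • v)
  rw [rho_apply, ← mul_smul, one_mul] at he
  rw [ddTmul_apply, ← map_smul, TensorProduct.smul_tmul', smul_eq_mul, dd, ← ddOd]
  refine Eq.trans ?_ he
  rw [← ι_odd_mul_odd, TensorProduct.add_tmul, map_add, hm, add_zero]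

/-- The map `v ↦ ∑ dᵢᵃ ⊗ ∂ᵢ ∂ₐ v`. -/
def nablaVec (X : Ty) : VX X →ₗ[ℂ] MX X :=
  ∑ i, ∑ a, (Induced.mk (modX X)).restrictScalars ℂ ∘ₗ TensorProduct.mk ℂ L.U (VX X) (dd i a) ∘ₗ
    Algebra.lsmul ℂ ℂ (VX X) (p (.inl i) * p (.inr a))

theorem nablaVec_apply (X : Ty) (v : VX X) :
    nablaVec X v = ∑ i, ∑ a, ddTmul X v i a (p (.inl i) * p (.inr a)) := by
  simp only [nablaVec, LinearMap.sum_apply]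
  rfl

/-- The matrix terms agree after exchanging summation indices, and the scalar terms agree because -1
+ 1/2 = -1/2: the trace coefficients of the two blocks of `actMat` add up to the twist of `dᵢᵃ`. -/
theorem even_smul_nablaVec (X : Ty) (x : L0.even) (v : VX X) :
    L.ι ((x : Ev), 0) • nablaVec X v = nablaVec X ((modX X).ρ x v) := by
  -- Moves the action on `v` into the `H`-argument, so that both sides involve the same `v` and
  -- `glToH_mul_p_p` applies.
  have hr (i : Fin 3) (a : Fin 2) (g h : H) :
      ddTmul X (g • v) i a h = ddTmul X v i a (h * g) := by
    rw [ddTmul_apply, ddTmul_apply, mul_smul]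
  simp only [nablaVec_apply, rho_apply, hr, Finset.smul_sum, even_smul_ddTmul]
  simp only [actMat_eq, glToH_mul_p_p, map_add, map_sum, map_smul, Matrix.add_apply,
    Matrix.sub_apply, Matrix.smul_apply, Matrix.map_apply, Matrix.one_apply, Matrix.trace,
    Matrix.diag, Fin.sum_univ_three, Fin.sum_univ_two, Fin.reduceEq, if_true, if_false,
    one_ne_zero, zero_ne_one, smul_eq_mul, mul_one, mul_zero, add_zero, sub_zero, Fin.isValue]
  module

theorem odd_smul_nablaVec (X : Ty) (x : L0.odd) (v : VX X) :
    L.ι (0, (x : Od)) • nablaVec X v = 0 := by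
  simp only [nablaVec_apply, Finset.smul_sum, odd_smul_ddTmul, ← map_sum, ← TensorProduct.tmul_sum,
    ← Finset.sum_smul, sum_glToH_ooFun x x.2, zero_smul, TensorProduct.tmul_zero, map_zero]

/-! ### The square of `∇` -/

theorem nabla_eq (X : Ty) :
    nabla X = ∑ s : Fin 3 × Fin 2, dd s.1 s.2 ⊗ₜ[ℂ] (pX X (.inl s.1) * pX X (.inr s.2)) := by
  simp only [nabla, Del, del, Finset.sum_mul, Algebra.TensorProduct.tmul_mul_tmul, mul_one,
    Fintype.sum_prod_type, Fin.sum_univ_two, Finset.sum_add_distrib]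

theorem pX_comm (X : Ty) (i j : Idx) : pX X i * pX X j = pX X j * pX X i := by
  rw [pX, pX, ← map_mul, p_p, map_mul]

theorem pX_mul_comm (X : Ty) (s t : Fin 3 × Fin 2) :
    (pX X (.inl s.1) * pX X (.inr s.2)) * (pX X (.inl t.1) * pX X (.inr t.2))
      = (pX X (.inl t.1) * pX X (.inr t.2)) * (pX X (.inl s.1) * pX X (.inr s.2)) := by
  have h (i j : Idx) : Commute (pX X i) (pX X j) := pX_comm X i j
  exact ((h _ _).mul_right (h _ _)).mul_left ((h _ _).mul_right (h _ _))

theorem pX_mul_swap (X : Ty) (s t : Fin 3 × Fin 2) :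
    (pX X (.inl s.1) * pX X (.inr s.2)) * (pX X (.inl t.1) * pX X (.inr t.2))
      = (pX X (.inl t.1) * pX X (.inr s.2)) * (pX X (.inl s.1) * pX X (.inr t.2)) := by
  rw [mul_assoc, ← mul_assoc (pX X (.inr s.2)), pX_comm X (.inr s.2), mul_assoc, ← mul_assoc,
    pX_comm X (.inl s.1), mul_assoc, mul_assoc, ← mul_assoc (pX X (.inl s.1)),
    pX_comm X (.inl s.1), mul_assoc]

theorem nabla_mul_nabla_eq_sum (X : Ty) :
    nabla X * nabla X = ∑ s : Fin 3 × Fin 2, ∑ t : Fin 3 × Fin 2, (dd s.1 s.2 * dd t.1 t.2) ⊗ₜ[ℂ]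
      ((pX X (.inl s.1) * pX X (.inr s.2)) * (pX X (.inl t.1) * pX X (.inr t.2))) := by
  rw [nabla_eq, Finset.sum_mul_sum]
  simp only [Algebra.TensorProduct.tmul_mul_tmul]

/-- Two symmetrizations: exchanging the pairs `s = (i, a)` and `t = (j, b)` turns products `d d`
into brackets, and exchanging only `i` and `j` then changes the sign of each term. -/
theorem nabla_mul_nabla (X : Ty) : nabla X * nabla X = 0 := by
  let F (s t : Fin 3 × Fin 2) : L.U ⊗[ℂ] Module.End ℂ (VX X) := (dd s.1 s.2 * dd t.1 t.2) ⊗ₜ[ℂ]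
      ((pX X (.inl s.1) * pX X (.inr s.2)) * (pX X (.inl t.1) * pX X (.inr t.2)))
  let K (s t : Fin 3 × Fin 2) : L.U ⊗[ℂ] Module.End ℂ (VX X) :=
    L.ι (L.oo (ddOd s.1 s.2) (ddOd t.1 t.2), 0) ⊗ₜ[ℂ]
      ((pX X (.inl s.1) * pX X (.inr s.2)) * (pX X (.inl t.1) * pX X (.inr t.2)))
  have hS : nabla X * nabla X = ∑ s, ∑ t, F s t := nabla_mul_nabla_eq_sum X
  -- The operator factors of `F s t` and `F t s` coincide, so the odd-odd relation of `U(L)` applies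
  -- to the first factors.
  have h1 (s t) : F s t + F t s = K s t := by
    simp only [F, K]
    rw [pX_mul_comm X t s, ← TensorProduct.add_tmul, ← ι_odd_mul_odd]
    rfl
  have h2 (s t : Fin 3 × Fin 2) : K s t + K (t.1, s.2) (s.1, t.2) = 0 := by
    have hn (x : Ev) : L.ι (-x, (0 : Od)) = -L.ι (x, 0) :=
      map_neg (L.ι ∘ₗ LinearMap.inl ℂ Ev Od) x
    simp only [K]
    rw [L_oo_ddOd_swap s.1, hn, pX_mul_swap X s t, ← TensorProduct.add_tmul, neg_add_cancel,
      TensorProduct.zero_tmul]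
  have h3 : ∑ s, ∑ t, K s t = ∑ s, ∑ t, F s t + ∑ s, ∑ t, F s t := by
    simp only [← h1, Finset.sum_add_distrib]
    rw [Finset.sum_comm (f := fun s t => F t s)]
  -- Exchanging the `x`-indices of `s` and `t` is an involution on pairs, so it only reorders the
  -- sum.
  have h4 : ∑ s : Fin 3 × Fin 2, ∑ t : Fin 3 × Fin 2, K (t.1, s.2) (s.1, t.2)
      = ∑ s, ∑ t, K s t := by
    simp only [Fintype.sum_prod_type]
    calc ∑ i, ∑ a, ∑ j, ∑ b, K (j, a) (i, b)
        = ∑ i, ∑ j, ∑ a, ∑ b, K (j, a) (i, b) :=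
          Finset.sum_congr rfl fun i _ => Finset.sum_comm
      _ = ∑ j, ∑ i, ∑ a, ∑ b, K (j, a) (i, b) := Finset.sum_comm
      _ = _ := Finset.sum_congr rfl fun i _ => Finset.sum_comm
  have h5 : ∑ s, ∑ t, K s t + ∑ s, ∑ t, K s t = 0 := by
    nth_rewrite 2 [← h4]
    simp only [← Finset.sum_add_distrib, h2, Finset.sum_const_zero]
  rw [h3, ← hS] at h5
  -- The sum of all `K s t` is `2∇²` by `h3`, and twice that sum is zero by `h5`.
  have h6 : (4 : ℂ) • (nabla X * nabla X) = 0 := by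
    rw [← h5]
    module
  exact (smul_eq_zero.mp h6).resolve_left (by norm_num)

/-! ### From `∇` to the morphism `φ` -/

theorem insertInto_nabla (X : Ty) (u : L.U) (v : VX X) :
    Induced.mk (modX X) (insertInto (nabla X) u v) = u • nablaVec X v := by
  rw [nabla_eq, insertInto_sum, map_sum, nablaVec_apply, Fintype.sum_prod_type]
  simp only [Finset.smul_sum, ddTmul_apply, ← map_smul, TensorProduct.smul_tmul', smul_eq_mul]
  simp only [insertInto_tmul, pX, ← map_mul]
  rfl

theorem GivenBy.comp_self {X : Ty} {φ : MX X →ₗ[L.U] MX X} (h : GivenBy (nabla X) φ) :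
    φ ∘ₗ φ = 0 := by
  refine Induced.hom_ext _ fun u v => ?_
  rw [LinearMap.comp_apply, h, LinearMap.zero_apply]
  have h0 : insertInto (nabla X * nabla X) u v = 0 := by rw [nabla_mul_nabla, insertInto_zero]
  rw [nabla_mul_nabla_eq_sum] at h0
  simp only [insertInto_sum, insertInto_tmul] at h0
  rw [← map_zero (Induced.mk (modX X)), ← h0, nabla_eq, insertInto_sum]
  simp only [map_sum]
  refine Finset.sum_congr rfl fun s _ => ?_
  rw [insertInto_tmul, h, nabla_eq, insertInto_sum, map_sum]
  refine Finset.sum_congr rfl fun t _ => ?_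
  -- Applying `φ` twice multiplies the `U(L)` factors in the order `s, t` but composes the operators
  -- in the order `t, s`; commutativity of the operators reconciles this with `∇²`.
  rw [insertInto_tmul, mul_assoc, pX_mul_comm X s t]
  rfl

end E38

end


/-! ### The proposition -/

theorem proposition3p2 (X : E38.Ty) :
    (∃! φ : E38.MX X →ₗ[E38.L.U] E38.MX X, E38.GivenBy (E38.nabla X) φ) ∧
    (∀ φ : E38.MX X →ₗ[E38.L.U] E38.MX X, E38.GivenBy (E38.nabla X) φ → φ ∘ₗ φ = 0) ∧
    E38.nabla X * E38.nabla X = 0 := by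
  refine ⟨⟨LieSuperalgebra.Induced.lift (E38.modX X) (E38.nablaVec X) (E38.even_smul_nablaVec X)
    (E38.odd_smul_nablaVec X), fun u v => ?_, fun ψ h => ?_⟩, fun φ h => h.comp_self,
    E38.nabla_mul_nabla X⟩
  · rw [LieSuperalgebra.Induced.lift_mk, E38.insertInto_nabla]
  -- Uniqueness: the prescribed formula fixes the map on the classes of pure tensors, which span
  -- `M(V_X)`.
  · refine LieSuperalgebra.Induced.hom_ext _ fun u v => ?_
    rw [h, LieSuperalgebra.Induced.lift_mk, E38.insertInto_nabla]
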